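/- Let $X$ be a smooth manifold of dimension $n$ (real, finite-dimensional, Hausdorff, paracompact and connected), let $\pi\colon Y\to X$ be a smooth real vector bundle of finite rank, and let $J^\infty Y=\varprojlim_r J^rY$ be its infinite-order jet space, with the projective limit topology and the projection $\pi^\infty\colon J^\infty Y\to X$. A bundle chart $(x^\lambda,y^i)$ of $Y$ induces coordinates $(x^\lambda,y^i_\Lambda)$, $|\Lambda|\ge 0$, on $J^\infty Y$ and the contact forms $\theta^i_\Lambda=dy^i_\Lambda-y^i_{\lambda+\Lambda}\,dx^\lambda$. A locally pull-back exterior form on $J^\infty Y$ is one which, in a neighbourhood of every point, is the pull-back of a smooth exterior form defined on an open subset of some finite-order jet manifold $J^rY$. For $k,m\ge 0$ let $\mathcal Q^{k,m}_\infty$ be the real vector space of locally pull-back exterior forms of degree $k+m$ on $J^\infty Y$ that are $k$-contact, i.e. that are locally sums of products of a function, exactly $k$ contact forms $\theta^i_\Lambda$ and exactly $m$ forms $dx^\lambda$. Let $$d_V\colon\mathcal Q^{k,m}_\infty\to\mathcal Q^{k+1,m}_\infty,\qquad d_V\phi=\theta^i_\Lambda\wedge\partial_i^\Lambda\phi ,$$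 be the vertical differential, where $\partial_i^\Lambda=\partial/\partial y^i_\Lambda$ acts on the coefficients of $\phi$ with respect to the generators $dx^\lambda,\theta^i_\Lambda$. Let $\mathcal Q^m(X)$ be the space of smooth exterior $m$-forms on $X$. Then for every $m\le n$ the vertical complex $$0\to \mathcal Q^m(X)\xrightarrow{\ \pi^{\infty *}\ }\mathcal Q^{0,m}_\infty\xrightarrow{\ d_V\ }\mathcal Q^{1,m}_\infty\xrightarrow{\ d_V\ }\cdots\xrightarrow{\ d_V\ }\mathcal Q^{k,m}_\infty\xrightarrow{\ d_V\ }\cdots$$ is exact: $\pi^{\infty *}$ and $d_V$ are well-defined linear maps between these spaces, $\pi^{\infty *}$ is injective, its image is the kernel of $d_V$ on $\mathcal Q^{0,m}_\infty$, and for every $k\ge 0$ the image of $d_V$ on $\mathcal Q^{k,m}_\infty$ is the kernel of $d_V$ on $\mathcal Q^{k+1,m}_\infty$. -/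

import Mathlib

open scoped Manifold ContDiff Topology
open Bundle

noncomputable section

namespace JetForms

variable {E : Type*} [NormedAddCommGroup E] [NormedSpace ℝ E]
  {X : Type*} [TopologicalSpace X] [ChartedSpace E X]

section Base

/-- The space of all (unrestricted) fields of real functions of `p` tangent vectors on `X`. -/
abbrev BasePreForm (E : Type*) [NormedAddCommGroup E] [NormedSpace ℝ E]
    (X : Type*) [TopologicalSpace X] [ChartedSpace E X] (p : ℕ) : Type _ :=
  (x : X) → (Fin p → TangentSpace 𝓘(ℝ, E) x) → ℝ

/-- The differential at `x` of the coordinates `x^λ` of the chart of `X` around `x₀`. -/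
def baseCoordDiff (x₀ x : X) : TangentSpace 𝓘(ℝ, E) x →L[ℝ] E :=
  mfderiv 𝓘(ℝ, E) 𝓘(ℝ, E) (extChartAt 𝓘(ℝ, E) x₀) x

/-- `φ` is a smooth exterior `p`-form on `X`: around every point it is the pull-back, by the
chart, of a smooth exterior form on an open subset of the model space. -/
def IsBaseForm {p : ℕ} (φ : BasePreForm E X p) : Prop :=
  ∀ x₀ : X, ∃ W : Set E, IsOpen W ∧ extChartAt 𝓘(ℝ, E) x₀ x₀ ∈ W ∧
    ∃ η : E → E [⋀^Fin p]→L[ℝ] ℝ, ContDiffOn ℝ ∞ η W ∧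
      ∀ x ∈ (chartAt E x₀).source, extChartAt 𝓘(ℝ, E) x₀ x ∈ W →
        ∀ w : Fin p → TangentSpace 𝓘(ℝ, E) x,
          φ x w = η (extChartAt 𝓘(ℝ, E) x₀ x) (fun i => baseCoordDiff x₀ x (w i))

/-- The vector space of smooth exterior `p`-forms on the manifold `X`. -/
def baseForms (E : Type*) [NormedAddCommGroup E] [NormedSpace ℝ E]
    (X : Type*) [TopologicalSpace X] [ChartedSpace E X] (p : ℕ) :
    Submodule ℝ (BasePreForm E X p) where
  carrier := {φ | IsBaseForm φ}
  zero_mem' := fun _ => ⟨Set.univ, isOpen_univ, Set.mem_univ _, 0, contDiffOn_const, by simp⟩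
  add_mem' := by
    intro φ ψ hφ hψ x₀
    obtain ⟨W, hW, hxW, η, hη, h⟩ := hφ x₀
    obtain ⟨W', hW', hxW', η', hη', h'⟩ := hψ x₀
    refine ⟨W ∩ W', hW.inter hW', ⟨hxW, hxW'⟩, η + η',
      (hη.mono Set.inter_subset_left).add (hη'.mono Set.inter_subset_right), ?_⟩
    intro x hx hxx w
    simp [h x hx hxx.1, h' x hx hxx.2]
  smul_mem' := by
    intro c φ hφ x₀
    obtain ⟨W, hW, hxW, η, hη, h⟩ := hφ x₀
    refine ⟨W, hW, hxW, c • η, contDiffOn_const.smul hη, ?_⟩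
    intro x hx hxx w
    simp [h x hx hxx]

end Base

variable (F : Type*) [NormedAddCommGroup F] [NormedSpace ℝ F]
  (Y : X → Type*) [TopologicalSpace (TotalSpace F Y)]
  [∀ x, AddCommGroup (Y x)] [∀ x, Module ℝ (Y x)] [∀ x, TopologicalSpace (Y x)]
  [FiberBundle F Y] [VectorBundle ℝ F Y]

/-! ### Jets of sections of the vector bundle `Y → X` -/

/-- The open set of `X` over which the bundle chart around `x₀` (a chart of `X` together with a
trivialization of `Y`) is defined. -/
def chartDom (x₀ : X) : Set X :=
  (chartAt E x₀).source ∩ (trivializationAt F Y x₀).baseSet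

set_option linter.unusedSectionVars false in
theorem mem_chartDom_self (x₀ : X) : x₀ ∈ chartDom (E := E) F Y x₀ :=
  ⟨mem_chart_source E x₀, mem_baseSet_trivializationAt F Y x₀⟩

/-- The local expression `u ↦ (y^i(s))(u)` of a section `s` in the bundle chart around `x₀`. -/
def localRep (x₀ : X) (s : ∀ x, Y x) : E → F :=
  fun u => (trivializationAt F Y x₀).continuousLinearMapAt ℝ
    ((extChartAt 𝓘(ℝ, E) x₀).symm u) (s ((extChartAt 𝓘(ℝ, E) x₀).symm u))

variable [IsManifold 𝓘(ℝ, E) ∞ X] [ContMDiffVectorBundle ∞ F Y 𝓘(ℝ, E)]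

/-- The sections of `Y → X` that are smooth on some neighbourhood of `x`. -/
def smoothNear (x : X) : Submodule ℝ (∀ x, Y x) where
  carrier := {s | ∀ᶠ x' in 𝓝 x,
    ContMDiffAt 𝓘(ℝ, E) (𝓘(ℝ, E).prod 𝓘(ℝ, F)) ∞ (fun z => TotalSpace.mk' F z (s z)) x'}
  zero_mem' := Filter.Eventually.of_forall fun x' =>
    (contMDiff_zeroSection ℝ Y (F := F) (IB := 𝓘(ℝ, E)) (n := ∞)).contMDiffAt
  add_mem' := by
    intro s t hs ht
    filter_upwards [hs, ht] with x' h h' using h.add_section h'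
  smul_mem' := by
    intro c s hs
    filter_upwards [hs] with x' h using h.const_smul_section

theorem contDiffAt_localRep {x₀ x : X} (hx : x ∈ chartDom (E := E) F Y x₀)
    (s : smoothNear (E := E) F Y x) :
    ContDiffAt ℝ ∞ (localRep (E := E) F Y x₀ s.1) (extChartAt 𝓘(ℝ, E) x₀ x) := by
  have hsrc : x ∈ (extChartAt 𝓘(ℝ, E) x₀).source := by
    rw [extChartAt_source]; exact hx.1
  have hinv : (extChartAt 𝓘(ℝ, E) x₀).symm (extChartAt 𝓘(ℝ, E) x₀ x) = x :=
    (extChartAt 𝓘(ℝ, E) x₀).left_inv hsrc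
  have hs : ContMDiffAt 𝓘(ℝ, E) (𝓘(ℝ, E).prod 𝓘(ℝ, F)) ∞
      (fun z => TotalSpace.mk' F z (s.1 z)) x := Filter.Eventually.self_of_nhds s.2
  rw [(trivializationAt F Y x₀).contMDiffAt_section_iff hx.2] at hs
  have h2 : ContMDiffAt 𝓘(ℝ, E) 𝓘(ℝ, F) ∞
      (fun z => (trivializationAt F Y x₀).continuousLinearMapAt ℝ z (s.1 z)) x := by
    refine hs.congr_of_eventuallyEq ?_
    filter_upwards [(trivializationAt F Y x₀).open_baseSet.mem_nhds hx.2] with z hz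
    exact (trivializationAt F Y x₀).continuousLinearMapAt_apply_of_mem ℝ hz _
  have h3 : ContMDiffAt 𝓘(ℝ, E) 𝓘(ℝ, E) ∞ (extChartAt 𝓘(ℝ, E) x₀).symm
      (extChartAt 𝓘(ℝ, E) x₀ x) :=
    (contMDiffOn_extChartAt_symm x₀).contMDiffAt (extChartAt_target_mem_nhds' ((extChartAt 𝓘(ℝ, E) x₀).map_source hsrc))
  rw [← contMDiffAt_iff_contDiffAt]
  exact ContMDiffAt.comp _ (by rw [hinv]; exact h2) h3

/-- `∂^k`: the `k`-th derivative at (the coordinate value of) `x` of the local expression of a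
section in the bundle chart around `x₀`. Its components are the jet coordinates `y^i_Λ`,
`|Λ| = k`. -/
def sectionDeriv (x₀ x : X) (hx : x ∈ chartDom (E := E) F Y x₀) (k : ℕ) :
    smoothNear (E := E) F Y x →ₗ[ℝ] E [×k]→L[ℝ] F where
  toFun s := iteratedFDeriv ℝ k (localRep F Y x₀ s.1) (extChartAt 𝓘(ℝ, E) x₀ x)
  map_add' s t := by
    have h : localRep (E := E) F Y x₀ (s + t).1
        = localRep F Y x₀ s.1 + localRep F Y x₀ t.1 := by
      funext u; exact map_add _ _ _
    rw [h]
    exact iteratedFDeriv_add_apply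
      ((contDiffAt_localRep F Y hx s).of_le (by exact_mod_cast le_top))
      ((contDiffAt_localRep F Y hx t).of_le (by exact_mod_cast le_top))
  map_smul' c s := by
    have h : localRep (E := E) F Y x₀ (c • s).1 = c • localRep F Y x₀ s.1 := by
      funext u; exact map_smul _ _ _
    rw [h]
    exact iteratedFDeriv_const_smul_apply
      ((contDiffAt_localRep F Y hx s).of_le (by exact_mod_cast le_top))

/-- The sections near `x` whose partial derivatives up to order `r` vanish at `x` in every bundle
chart. -/
def flat (r : ℕ) (x : X) : Submodule ℝ (smoothNear (E := E) F Y x) :=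
  ⨅ (x₀ : X) (hx : x ∈ chartDom (E := E) F Y x₀) (k : ℕ) (_ : k ≤ r),
    LinearMap.ker (sectionDeriv F Y x₀ x hx k)

theorem flat_anti {r r' : ℕ} (h : r ≤ r') (x : X) :
    flat (E := E) F Y r' x ≤ flat F Y r x := by
  intro s hs
  simp only [flat, Submodule.mem_iInf] at hs ⊢
  exact fun x₀ hx k hk => hs x₀ hx k (hk.trans h)

/-- The fibre `J^r_x Y`: two local sections have the same `r`-jet at `x` iff they have the same
partial derivatives at `x` up to order `r`. -/
abbrev Jet (E : Type*) [NormedAddCommGroup E] [NormedSpace ℝ E]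
    {X : Type*} [TopologicalSpace X] [ChartedSpace E X]
    (F : Type*) [NormedAddCommGroup F] [NormedSpace ℝ F]
    (Y : X → Type*) [TopologicalSpace (TotalSpace F Y)]
    [∀ x, AddCommGroup (Y x)] [∀ x, Module ℝ (Y x)] [∀ x, TopologicalSpace (Y x)]
    [FiberBundle F Y] [VectorBundle ℝ F Y]
    [IsManifold 𝓘(ℝ, E) ∞ X] [ContMDiffVectorBundle ∞ F Y 𝓘(ℝ, E)]
    (r : ℕ) (x : X) : Type _ :=
  smoothNear (E := E) F Y x ⧸ flat (E := E) F Y r x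

/-- The projection `π^{r+1}_r : J^{r+1}_x Y → J^r_x Y`. -/
def jetProj (r : ℕ) (x : X) : Jet E F Y (r + 1) x →ₗ[ℝ] Jet E F Y r x :=
  Submodule.factor (flat_anti F Y r.le_succ x)

/-- The fibre `J^∞_x Y` of the infinite-order jet space, the projective limit of the `J^r_x Y`. -/
def JetInf (E : Type*) [NormedAddCommGroup E] [NormedSpace ℝ E]
    {X : Type*} [TopologicalSpace X] [ChartedSpace E X]
    (F : Type*) [NormedAddCommGroup F] [NormedSpace ℝ F]
    (Y : X → Type*) [TopologicalSpace (TotalSpace F Y)]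
    [∀ x, AddCommGroup (Y x)] [∀ x, Module ℝ (Y x)] [∀ x, TopologicalSpace (Y x)]
    [FiberBundle F Y] [VectorBundle ℝ F Y]
    [IsManifold 𝓘(ℝ, E) ∞ X] [ContMDiffVectorBundle ∞ F Y 𝓘(ℝ, E)]
    (x : X) : Submodule ℝ (∀ r, Jet E F Y r x) where
  carrier := {q | ∀ r, jetProj F Y r x (q (r + 1)) = q r}
  zero_mem' := by intro r; simp
  add_mem' := by
    intro q q' h h' r
    simp [h r, h' r]
  smul_mem' := by
    intro c q h r
    simp [h r]

/-- The coordinates `y^i_Λ`, `|Λ| = k`, of an infinite-order jet over `x`, in the bundle chart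
around `x₀`. -/
def jetCoord (x₀ x : X) (hx : x ∈ chartDom (E := E) F Y x₀) (k : ℕ) :
    JetInf E F Y x →ₗ[ℝ] E [×k]→L[ℝ] F :=
  (Submodule.liftQ (flat F Y k x) (sectionDeriv F Y x₀ x hx k) (by
    intro s hs
    simp only [flat, Submodule.mem_iInf] at hs
    exact hs x₀ hx k le_rfl)) ∘ₗ (LinearMap.proj k) ∘ₗ (JetInf E F Y x).subtype

/-- The infinite-order jet space `J^∞ Y`; its points are `q = ⟨x, j⟩`, `x = π^∞ q`. -/
abbrev JetSpace (E : Type*) [NormedAddCommGroup E] [NormedSpace ℝ E]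
    {X : Type*} [TopologicalSpace X] [ChartedSpace E X]
    (F : Type*) [NormedAddCommGroup F] [NormedSpace ℝ F]
    (Y : X → Type*) [TopologicalSpace (TotalSpace F Y)]
    [∀ x, AddCommGroup (Y x)] [∀ x, Module ℝ (Y x)] [∀ x, TopologicalSpace (Y x)]
    [FiberBundle F Y] [VectorBundle ℝ F Y]
    [IsManifold 𝓘(ℝ, E) ∞ X] [ContMDiffVectorBundle ∞ F Y 𝓘(ℝ, E)] : Type _ :=
  Σ x : X, JetInf E F Y x

/-- The tangent space `T_q J^∞ Y`. The Cartan connection splits it canonically into the horizontal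
subspace, identified with `T_x X` (the common kernel of the contact forms, spanned by the total
derivatives `d_λ`), and the vertical subspace tangent to the fibre, which is the vector space
`J^∞_x Y` itself (spanned by the `∂_i^Λ`). A pair `(w, v)` stands for the tangent vector
`w^λ d_λ + v^i_Λ ∂_i^Λ`, so that `dx^λ (w, v) = w^λ` and
`θ^i_Λ (w, v) = (dy^i_Λ - y^i_{λ+Λ} dx^λ) (w, v) = v^i_Λ`. -/
abbrev TangentJet {E : Type*} [NormedAddCommGroup E] [NormedSpace ℝ E]
    {X : Type*} [TopologicalSpace X] [ChartedSpace E X]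
    {F : Type*} [NormedAddCommGroup F] [NormedSpace ℝ F]
    {Y : X → Type*} [TopologicalSpace (TotalSpace F Y)]
    [∀ x, AddCommGroup (Y x)] [∀ x, Module ℝ (Y x)] [∀ x, TopologicalSpace (Y x)]
    [FiberBundle F Y] [VectorBundle ℝ F Y]
    [IsManifold 𝓘(ℝ, E) ∞ X] [ContMDiffVectorBundle ∞ F Y 𝓘(ℝ, E)]
    (q : JetSpace E F Y) : Type _ :=
  TangentSpace 𝓘(ℝ, E) q.1 × JetInf E F Y q.1

/-! ### Finite-order jet coordinates -/

/-- The coordinate space of order-`r` jets: `(x^λ, y^i_Λ)`, `|Λ| ≤ r`, where the `y^i_Λ` with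
`|Λ| = k` form a `k`-linear map `E^k → F`. The coordinates of jets fill the linear subspace of
symmetric multilinear maps; smooth forms on open sets of that subspace are the same as
restrictions of smooth forms on open sets of the whole space. -/
def CoordSpace (E : Type*) [NormedAddCommGroup E] [NormedSpace ℝ E]
    (F : Type*) [NormedAddCommGroup F] [NormedSpace ℝ F] (r : ℕ) : Type _ :=
  E × (∀ k : Fin (r + 1), E [×(k : ℕ)]→L[ℝ] F)

instance (E : Type*) [NormedAddCommGroup E] [NormedSpace ℝ E]
    (F : Type*) [NormedAddCommGroup F] [NormedSpace ℝ F] (r : ℕ) :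
    NormedAddCommGroup (CoordSpace E F r) :=
  inferInstanceAs (NormedAddCommGroup (E × (∀ k : Fin (r + 1), E [×(k : ℕ)]→L[ℝ] F)))

instance (E : Type*) [NormedAddCommGroup E] [NormedSpace ℝ E]
    (F : Type*) [NormedAddCommGroup F] [NormedSpace ℝ F] (r : ℕ) :
    NormedSpace ℝ (CoordSpace E F r) :=
  inferInstanceAs (NormedSpace ℝ (E × (∀ k : Fin (r + 1), E [×(k : ℕ)]→L[ℝ] F)))

/-- Forgetting the coordinates of order higher than `r`. -/
def coordTrunc (E : Type*) [NormedAddCommGroup E] [NormedSpace ℝ E]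
    (F : Type*) [NormedAddCommGroup F] [NormedSpace ℝ F] {r r' : ℕ} (h : r ≤ r') :
    CoordSpace E F r' →L[ℝ] CoordSpace E F r :=
  (ContinuousLinearMap.fst ℝ E (∀ k : Fin (r' + 1), E [×(k : ℕ)]→L[ℝ] F)).prod
    (ContinuousLinearMap.pi fun k : Fin (r + 1) =>
      (ContinuousLinearMap.proj (R := ℝ) (φ := fun k : Fin (r' + 1) => E [×(k : ℕ)]→L[ℝ] F)
        (Fin.castLE (Nat.succ_le_succ h) k)) ∘L
          ContinuousLinearMap.snd ℝ E (∀ k : Fin (r' + 1), E [×(k : ℕ)]→L[ℝ] F))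

variable {F Y}

/-- The coordinates `(x^λ, y^i_Λ)`, `|Λ| ≤ r`, in the bundle chart around `x₀`. -/
def coord (r : ℕ) (x₀ : X) (q : JetSpace E F Y) (hq : q.1 ∈ chartDom (E := E) F Y x₀) :
    CoordSpace E F r :=
  (extChartAt 𝓘(ℝ, E) x₀ q.1, fun k => jetCoord F Y x₀ q.1 hq k q.2)

/-- The differentials at `q` of the coordinates in the bundle chart around `x₀`:
`dx^λ` and `dy^i_Λ = θ^i_Λ + y^i_{λ+Λ} dx^λ`, `|Λ| ≤ r`, evaluated on a tangent vector. -/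
def coordDiff (r : ℕ) (x₀ : X) (q : JetSpace E F Y) (hq : q.1 ∈ chartDom (E := E) F Y x₀)
    (ξ : TangentJet q) : CoordSpace E F r :=
  (baseCoordDiff x₀ q.1 ξ.1, fun k =>
    jetCoord F Y x₀ q.1 hq k ξ.2 +
      (jetCoord F Y x₀ q.1 hq (k + 1) q.2).curryLeft (baseCoordDiff x₀ q.1 ξ.1))

/-! ### Locally pull-back exterior forms -/

variable (E F Y)

/-- The space of all (unrestricted) fields of real functions of `p` tangent vectors on `J^∞ Y`. -/
abbrev PreForm (E : Type*) [NormedAddCommGroup E] [NormedSpace ℝ E]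
    {X : Type*} [TopologicalSpace X] [ChartedSpace E X]
    (F : Type*) [NormedAddCommGroup F] [NormedSpace ℝ F]
    (Y : X → Type*) [TopologicalSpace (TotalSpace F Y)]
    [∀ x, AddCommGroup (Y x)] [∀ x, Module ℝ (Y x)] [∀ x, TopologicalSpace (Y x)]
    [FiberBundle F Y] [VectorBundle ℝ F Y]
    [IsManifold 𝓘(ℝ, E) ∞ X] [ContMDiffVectorBundle ∞ F Y 𝓘(ℝ, E)] (p : ℕ) : Type _ :=
  (q : JetSpace E F Y) → (Fin p → TangentJet q) → ℝ

variable {E F Y}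

/-- `φ` is a locally pull-back exterior `p`-form on `J^∞ Y`: around every point `q₀` there is a
neighbourhood in the projective limit topology (the preimage of an open subset `W` of some
finite-order jet manifold, taken in coordinates) on which `φ` is the pull-back of a smooth exterior
form `η` on `W`. -/
def IsLocPullback {p : ℕ} (φ : PreForm E F Y p) : Prop :=
  ∀ q₀ : JetSpace E F Y,
    ∃ (r : ℕ) (W : Set (CoordSpace E F r)), IsOpen W ∧
      coord r q₀.1 q₀ (mem_chartDom_self F Y q₀.1) ∈ W ∧
      ∃ η : CoordSpace E F r → CoordSpace E F r [⋀^Fin p]→L[ℝ] ℝ, ContDiffOn ℝ ∞ η W ∧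
        ∀ (q : JetSpace E F Y) (hq : q.1 ∈ chartDom (E := E) F Y q₀.1),
          coord r q₀.1 q hq ∈ W → ∀ ξ : Fin p → TangentJet q,
            φ q ξ = η (coord r q₀.1 q hq) (fun i => coordDiff r q₀.1 q hq (ξ i))

/-- `φ` is `k`-contact: it lies in the span of products of exactly `k` contact forms `θ^i_Λ` and
of forms `dx^λ`, i.e. it vanishes on every tuple of vertical and horizontal vectors in which the
number of vertical ones is not `k`. -/
def IsContact {p : ℕ} (k : ℕ) (φ : PreForm E F Y p) : Prop :=
  ∀ (q : JetSpace E F Y) (ξ : Fin p → TangentJet q) (S : Finset (Fin p)),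
    (∀ i ∈ S, (ξ i).1 = 0) → (∀ i ∉ S, (ξ i).2 = 0) → S.card ≠ k → φ q ξ = 0

theorem IsLocPullback.add {p : ℕ} {φ ψ : PreForm E F Y p} (hφ : IsLocPullback φ)
    (hψ : IsLocPullback ψ) : IsLocPullback (φ + ψ) := by
  intro q₀
  obtain ⟨r, W, hW, hqW, η, hη, h⟩ := hφ q₀
  obtain ⟨r', W', hW', hqW', η', hη', h'⟩ := hψ q₀
  let T := coordTrunc E F (le_max_left r r')
  let T' := coordTrunc E F (le_max_right r r')
  refine ⟨max r r', T ⁻¹' W ∩ T' ⁻¹' W',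
    (hW.preimage T.continuous).inter (hW'.preimage T'.continuous), ⟨hqW, hqW'⟩,
    fun c => (η (T c)).compContinuousLinearMap T + (η' (T' c)).compContinuousLinearMap T', ?_, ?_⟩
  · let L : (CoordSpace E F r [⋀^Fin p]→L[ℝ] ℝ) →L[ℝ]
        (CoordSpace E F (max r r') [⋀^Fin p]→L[ℝ] ℝ) :=
      ContinuousAlternatingMap.compContinuousLinearMapCLM T
    let L' : (CoordSpace E F r' [⋀^Fin p]→L[ℝ] ℝ) →L[ℝ]
        (CoordSpace E F (max r r') [⋀^Fin p]→L[ℝ] ℝ) :=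
      ContinuousAlternatingMap.compContinuousLinearMapCLM T'
    have e1 : ContDiffOn ℝ ∞ (fun c => L (η (T c))) (T ⁻¹' W ∩ T' ⁻¹' W') :=
      L.contDiff.comp_contDiffOn (hη.comp T.contDiff.contDiffOn fun c hc => hc.1)
    have e2 : ContDiffOn ℝ ∞ (fun c => L' (η' (T' c))) (T ⁻¹' W ∩ T' ⁻¹' W') :=
      L'.contDiff.comp_contDiffOn (hη'.comp T'.contDiff.contDiffOn fun c hc => hc.2)
    exact e1.add e2
  · intro q hq hqq ξ
    have := h q hq hqq.1 ξ
    have := h' q hq hqq.2 ξ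
    simp only [Pi.add_apply, *]
    rfl

/-- `Q^{k,m}_∞`: the vector space of `k`-contact locally pull-back exterior forms of degree
`m + k` on `J^∞ Y`. -/
def contactForms (E : Type*) [NormedAddCommGroup E] [NormedSpace ℝ E]
    {X : Type*} [TopologicalSpace X] [ChartedSpace E X]
    (F : Type*) [NormedAddCommGroup F] [NormedSpace ℝ F]
    (Y : X → Type*) [TopologicalSpace (TotalSpace F Y)]
    [∀ x, AddCommGroup (Y x)] [∀ x, Module ℝ (Y x)] [∀ x, TopologicalSpace (Y x)]
    [FiberBundle F Y] [VectorBundle ℝ F Y]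
    [IsManifold 𝓘(ℝ, E) ∞ X] [ContMDiffVectorBundle ∞ F Y 𝓘(ℝ, E)] (k m : ℕ) :
    Submodule ℝ (PreForm E F Y (m + k)) where
  carrier := {φ | IsLocPullback φ ∧ IsContact k φ}
  zero_mem' := ⟨fun _ => ⟨0, Set.univ, isOpen_univ, Set.mem_univ _, 0, contDiffOn_const,
    by simp⟩, fun _ _ _ _ _ _ => rfl⟩
  add_mem' := by
    intro φ ψ hφ hψ
    refine ⟨hφ.1.add hψ.1, fun q ξ S h1 h2 h3 => ?_⟩
    simp [hφ.2 q ξ S h1 h2 h3, hψ.2 q ξ S h1 h2 h3]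
  smul_mem' := by
    intro c φ hφ
    refine ⟨fun q₀ => ?_, fun q ξ S h1 h2 h3 => ?_⟩
    · obtain ⟨r, W, hW, hqW, η, hη, h⟩ := hφ.1 q₀
      refine ⟨r, W, hW, hqW, c • η, contDiffOn_const.smul hη, ?_⟩
      intro q hq hqq ξ
      simp [h q hq hqq]
    · simp [hφ.2 q ξ S h1 h2 h3]

/-- The pull-back `π^{∞*}` of a form on `X` by the projection `π^∞ : J^∞ Y → X`, whose tangent map
is `(w, v) ↦ w`. -/
def pullbackBase {p : ℕ} (α : BasePreForm E X p) : PreForm E F Y p :=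
  fun q ξ => α q.1 (fun i => (ξ i).1)

/-- The vertical differential `d_V φ = θ^i_Λ ∧ ∂_i^Λ φ`. On tangent vectors `ξ_0, …, ξ_p` it is
`∑ (-1)^i (∂_{v_i} φ) (ξ_0, …, ξ_p without ξ_i)`, with `v_i = θ (ξ_i)` the vertical part of `ξ_i`.
The derivative is taken along the fibre `J^∞_x Y`, with the values of the `dx^λ` and `θ^i_Λ` on
the remaining vectors (their components `w_j`, `v_j`) held fixed, so it acts on the coefficients of
`φ` with respect to the generators `dx^λ`, `θ^i_Λ`. -/
def vertDiff {p : ℕ} (φ : PreForm E F Y p) : PreForm E F Y (p + 1) :=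
  fun q ξ => ∑ i : Fin (p + 1), (-1 : ℝ) ^ (i : ℕ) *
    deriv (fun t : ℝ => φ ⟨q.1, q.2 + t • (ξ i).2⟩ (fun j => ξ (i.succAbove j))) 0

end JetForms

end

/-! The fibres of `J^∞ Y → X` are vector spaces, and `(x, j) ↦ (x, t j)` contracts them onto the
zero section. The theorem is the Poincaré lemma for this contraction, with the horizontal directions
as parameters. The contraction is defined without charts, so primitives come from one global
formula, `homotopyForm`, and nothing has to be glued over `X`.

In the generators `dx^λ`, `θ^i_Λ` of a bundle chart, `d_V` differentiates coefficients in vertical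
directions only: it becomes `extDerivAlong` for the projection `vertProj` of a finite-dimensional
coordinate space (`IsFrameRepr.vertDiff`). Passing between these generators and `dx^λ`, `dy^i_Λ`
costs one jet order. Then `d_V ∘ d_V = 0` is the symmetry of second derivatives, and
`extDerivAlong_homotopyOp` is the homotopy formula: on a closed form, `d_V` of the homotopy operator
gives the form minus its pull-back by the contraction at `t = 0`. That pull-back sees only
horizontal vectors, so it vanishes when there is at least one contact factor.

The difficulty of infinite order is that the operator integrates along the whole segment from a jet
to the zero jet, and the order of a locally pull-back form may vary along it.
`IsLocPullback.exists_frameRepr_segment` uses compactness to select finitely many local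
representatives, then patches them by a partition of unity in one finite-order coordinate space.

In contact degree zero, a closed form is constant along lines in the fibres, hence is the pull-back
of its restriction to the zero section (`eq_pullbackBase_zeroSectionForm`). -/

noncomputable section

namespace JetForms

/-! ### Smooth families of alternating maps and parametric integrals. -/

section Analysis

instance finiteDimensional_continuousMultilinearMap {ι : Type*} [Fintype ι] {V : ι → Type*}
    {H : Type*} [∀ i, NormedAddCommGroup (V i)] [∀ i, NormedSpace ℝ (V i)]
    [∀ i, FiniteDimensional ℝ (V i)]
    [NormedAddCommGroup H] [NormedSpace ℝ H] [FiniteDimensional ℝ H] :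
    FiniteDimensional ℝ (ContinuousMultilinearMap ℝ V H) :=
  Module.Finite.of_injective
    (ContinuousMultilinearMap.toMultilinearMapLinear :
      ContinuousMultilinearMap ℝ V H →ₗ[ℝ] MultilinearMap ℝ V H)
    ContinuousMultilinearMap.toMultilinearMap_injective

instance finiteDimensional_continuousAlternatingMap {ι : Type*} [Fintype ι] {V H : Type*}
    [NormedAddCommGroup V] [NormedSpace ℝ V] [FiniteDimensional ℝ V]
    [NormedAddCommGroup H] [NormedSpace ℝ H] [FiniteDimensional ℝ H] :
    FiniteDimensional ℝ (V [⋀^ι]→L[ℝ] H) :=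
  Module.Finite.of_injective
    (ContinuousAlternatingMap.toContinuousMultilinearMapCLM (𝕜 := ℝ) (E := V) (F := H)
      (ι := ι) ℝ).toLinearMap
    ContinuousAlternatingMap.toContinuousMultilinearMap_injective

variable {U V : Type*} [NormedAddCommGroup U] [NormedSpace ℝ U]
  [NormedAddCommGroup V] [NormedSpace ℝ V] {p : ℕ}

theorem contDiffOn_alternatingMap_apply {n : WithTop ℕ∞} {f : U → V [⋀^Fin p]→L[ℝ] ℝ}
    {a : Fin p → U → V} {s : Set U} (hf : ContDiffOn ℝ n f s)
    (ha : ∀ i, ContDiffOn ℝ n (a i) s) : ContDiffOn ℝ n (fun z => f z (fun i => a i z)) s := by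
  have h := (ContinuousLinearMap.cpolynomialOn_uncurry_of_multilinear
    (ContinuousAlternatingMap.toContinuousMultilinearMapCLM (𝕜 := ℝ) (E := V) (F := ℝ)
      (ι := Fin p) ℝ) (s := Set.univ)).contDiffOn (n := n)
  exact h.comp (hf.prodMk (contDiffOn_pi.2 ha)) (fun _ _ => Set.mem_univ _)

theorem contDiff_alternatingMap_apply {n : WithTop ℕ∞} {f : U → V [⋀^Fin p]→L[ℝ] ℝ}
    {a : Fin p → U → V} (hf : ContDiff ℝ n f)
    (ha : ∀ i, ContDiff ℝ n (a i)) : ContDiff ℝ n (fun z => f z (fun i => a i z)) := by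
  rw [← contDiffOn_univ] at hf ⊢
  exact contDiffOn_alternatingMap_apply hf fun i => (ha i).contDiffOn

/-- Evaluation on tuples of basis vectors is an injective linear map into a finite power of `ℝ`, so
it has a linear left inverse, which rebuilds `f` from finitely many scalar functions. -/
theorem contDiffOn_of_alternatingMap_apply [FiniteDimensional ℝ V] {n : WithTop ℕ∞}
    {f : U → V [⋀^Fin p]→L[ℝ] ℝ} {s : Set U}
    (hf : ∀ v : Fin p → V, ContDiffOn ℝ n (fun z => f z v) s) : ContDiffOn ℝ n f s := by
  let b := Module.finBasis ℝ V
  let ev : (V [⋀^Fin p]→L[ℝ] ℝ) →ₗ[ℝ] ((Fin p → Fin (Module.finrank ℝ V)) → ℝ) :=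
    { toFun := fun g v => g (fun i => b (v i))
      map_add' := fun _ _ => rfl
      map_smul' := fun _ _ => rfl }
  have hinj : LinearMap.ker ev = ⊥ := by
    rw [LinearMap.ker_eq_bot]
    intro g g' h
    apply ContinuousAlternatingMap.toAlternatingMap_injective
    exact b.ext_alternating fun v _ => congrFun h v
  obtain ⟨g, hg⟩ := ev.exists_leftInverse_of_injective hinj
  have hfg : f = fun z => g.toContinuousLinearMap (ev (f z)) := by
    funext z
    exact (LinearMap.congr_fun hg (f z)).symm
  rw [hfg]
  exact g.toContinuousLinearMap.contDiff.comp_contDiffOn (contDiffOn_pi.2 fun v => hf _)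

theorem contDiff_of_alternatingMap_apply [FiniteDimensional ℝ V] {n : WithTop ℕ∞}
    {f : U → V [⋀^Fin p]→L[ℝ] ℝ}
    (hf : ∀ v : Fin p → V, ContDiff ℝ n (fun z => f z v)) : ContDiff ℝ n f := by
  rw [← contDiffOn_univ]
  exact contDiffOn_of_alternatingMap_apply fun v => (hf v).contDiffOn

/-- A constant dominates: the partial derivative is continuous, hence bounded on the product of the
interval with a closed ball, compact because `U` is finite-dimensional. -/
theorem hasFDerivAt_parametric_intervalIntegral [FiniteDimensional ℝ U]
    {G : U × ℝ → V} (hG : ContDiff ℝ 1 G) (a b : ℝ) (z : U) :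
    HasFDerivAt (fun z => ∫ t in a..b, G (z, t))
      (∫ t in a..b, (fderiv ℝ G (z, t)).comp (ContinuousLinearMap.inl ℝ U ℝ)) z := by
  have hcont : Continuous fun y : U × ℝ =>
      (fderiv ℝ G y).comp (ContinuousLinearMap.inl ℝ U ℝ) :=
    (hG.continuous_fderiv one_ne_zero).clm_comp continuous_const
  obtain ⟨C, hC⟩ := ((isCompact_closedBall z 1).prod (isCompact_uIcc (a := a) (b := b))
    ).exists_bound_of_continuousOn hcont.continuousOn
  have hc : ∀ z : U, Continuous fun t : ℝ => (z, t) := fun z => by fun_prop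
  refine intervalIntegral.hasFDerivAt_integral_of_dominated_of_fderiv_le
    (F := fun z t => G (z, t))
    (F' := fun z t => (fderiv ℝ G (z, t)).comp (ContinuousLinearMap.inl ℝ U ℝ))
    (bound := fun _ => C)
    (Metric.closedBall_mem_nhds z one_pos) ?_ ?_ ?_ ?_ ?_ ?_
  · exact Filter.Eventually.of_forall fun y =>
      (hG.continuous.comp (hc y)).aestronglyMeasurable
  · exact (hG.continuous.comp (hc z)).intervalIntegrable _ _
  · exact (hcont.comp (hc z)).aestronglyMeasurable
  · exact Filter.Eventually.of_forall fun t ht y hy =>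
      hC (y, t) ⟨hy, Set.uIoc_subset_uIcc ht⟩
  · exact intervalIntegrable_const
  · refine Filter.Eventually.of_forall fun t _ y _ => ?_
    exact ((hG.differentiable one_ne_zero) (y, t)).hasFDerivAt.comp y
      (hasFDerivAt_prodMk_left y t)

/-- Induction on the order. Over a finite-dimensional `U` it suffices to treat the derivative in
each fixed direction, which is again a parametric integral with smooth integrand; hence the
induction over all `G`. -/
theorem contDiff_parametric_intervalIntegral [FiniteDimensional ℝ U] [CompleteSpace V]
    {G : U × ℝ → V} (hG : ContDiff ℝ ∞ G) (a b : ℝ) :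
    ContDiff ℝ ∞ (fun z => ∫ t in a..b, G (z, t)) := by
  rw [contDiff_infty]
  intro n
  induction n generalizing G with
  | zero =>
    exact contDiff_zero.2
      (intervalIntegral.continuous_parametric_intervalIntegral_of_continuous'
        (f := fun z t => G (z, t)) hG.continuous a b)
  | succ n ih =>
    have h := hasFDerivAt_parametric_intervalIntegral (hG.of_le (by exact_mod_cast le_top)) a b
    have hfd : ContDiff ℝ ∞ fun y : U × ℝ => fderiv ℝ G y :=
      hG.fderiv_right (by simp)
    rw [show ((n + 1 : ℕ) : WithTop ℕ∞) = (n : WithTop ℕ∞) + 1 by norm_cast,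
      contDiff_succ_iff_fderiv_apply]
    refine ⟨fun z => (h z).differentiableAt, fun h => absurd h (by simp), fun y => ?_⟩
    have key : (fun x => fderiv ℝ (fun z => ∫ t in a..b, G (z, t)) x y)
        = fun x => ∫ t in a..b, fderiv ℝ G (x, t) (y, 0) := by
      funext x
      rw [(h x).fderiv, ContinuousLinearMap.intervalIntegral_apply]
      · simp
      · refine Continuous.intervalIntegrable ?_ _ _
        exact (hfd.continuous.comp (by fun_prop : Continuous fun t : ℝ => (x, t))).clm_comp
          continuous_const
    rw [key]
    exact ih (G := fun w => fderiv ℝ G w (y, 0)) (hfd.clm_apply contDiff_const)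

end Analysis

/-! ### Exterior calculus along a linear projection, and its homotopy formula. -/

section PartialDeriv

variable {Z : Type*} [NormedAddCommGroup Z] [NormedSpace ℝ Z] {p : ℕ}

/-- The exterior derivative along the image of the linear map `P`. -/
def extDerivAlong (P : Z →L[ℝ] Z) (η : Z → Z [⋀^Fin p]→L[ℝ] ℝ) (z : Z) :
    Z [⋀^Fin (p + 1)]→L[ℝ] ℝ :=
  ContinuousAlternatingMap.alternatizeUncurryFin ((fderiv ℝ η z).comp P)

theorem extDerivAlong_apply (P : Z →L[ℝ] Z) (η : Z → Z [⋀^Fin p]→L[ℝ] ℝ) (z : Z)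
    (a : Fin (p + 1) → Z) :
    extDerivAlong P η z a
      = ∑ i : Fin (p + 1), (-1 : ℝ) ^ (i : ℕ) * fderiv ℝ η z (P (a i)) (i.removeNth a) := by
  simp [extDerivAlong, ContinuousAlternatingMap.alternatizeUncurryFin_apply]

theorem contDiffOn_extDerivAlong (P : Z →L[ℝ] Z) {η : Z → Z [⋀^Fin p]→L[ℝ] ℝ} {W : Set Z}
    (hW : IsOpen W) (hη : ContDiffOn ℝ ∞ η W) : ContDiffOn ℝ ∞ (extDerivAlong P η) W := by
  have h1 : ContDiffOn ℝ ∞ (fderiv ℝ η) W := hη.fderiv_of_isOpen hW (by simp)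
  exact (ContinuousAlternatingMap.alternatizeUncurryFinCLM ℝ Z ℝ).contDiff.comp_contDiffOn
    (h1.clm_comp contDiffOn_const)

/-- Composing the coefficients with the affine map `A` through `z` with linear part `P` turns
`extDerivAlong P` into the ordinary exterior derivative, whose square is zero. Only the base point
is moved, the arguments are not pulled back, so `P` need not be idempotent. -/
theorem extDerivAlong_extDerivAlong (P : Z →L[ℝ] Z) {η : Z → Z [⋀^Fin p]→L[ℝ] ℝ} {W : Set Z}
    (hW : IsOpen W) (hη : ContDiffOn ℝ ∞ η W) {z : Z} (hz : z ∈ W) :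
    extDerivAlong P (extDerivAlong P η) z = 0 := by
  let A : Z → Z := fun y => z + P (y - z)
  have hAz : A z = z := by simp [A]
  have hA : ∀ y, HasFDerivAt A P y := fun y =>
    (P.hasFDerivAt.comp y ((hasFDerivAt_id y).sub_const z)).const_add z
  have hAs : ContDiff ℝ ∞ A := by fun_prop
  have hW' : IsOpen (A ⁻¹' W) := hW.preimage hAs.continuous
  have hzW : z ∈ A ⁻¹' W := by rwa [Set.mem_preimage, hAz]
  have hη' : ContDiffOn ℝ ∞ (fun y => η (A y)) (A ⁻¹' W) :=
    hη.comp hAs.contDiffOn fun _ h => h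
  have h1 : ∀ y ∈ A ⁻¹' W, extDeriv (fun y => η (A y)) y = extDerivAlong P η (A y) := by
    intro y hy
    have hd : DifferentiableAt ℝ η (A y) :=
      (hη.contDiffAt (hW.mem_nhds hy)).differentiableAt (by simp)
    have h := hd.hasFDerivAt.comp y (hA y)
    simp only [Function.comp_def] at h
    rw [extDeriv, extDerivAlong, h.fderiv]
  have h2 := extDeriv_extDeriv_apply (hη'.contDiffAt (hW'.mem_nhds hzW))
    (by rw [minSmoothness_of_isRCLikeNormedField]; exact WithTop.coe_le_coe.2 (le_top : (2 : ℕ∞) ≤ ⊤))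
  have h3 : extDeriv (fun y => η (A y)) =ᶠ[𝓝 z] fun y => extDerivAlong P η (A y) :=
    Filter.eventuallyEq_of_mem (hW'.mem_nhds hzW) h1
  rw [h3.extDeriv_eq] at h2
  have hd : DifferentiableAt ℝ (extDerivAlong P η) (A z) := by
    rw [hAz]
    exact ((contDiffOn_extDerivAlong P hW hη).contDiffAt
      (hW.mem_nhds hz)).differentiableAt (by simp)
  have h := hd.hasFDerivAt.comp z (hA z)
  simp only [Function.comp_def] at h
  rwa [extDeriv, h.fderiv, hAz] at h2

/-- The contraction `z ↦ z - P z + t P z` onto the kernel of the projection `P`. -/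
def contraction (P : Z →L[ℝ] Z) (t : ℝ) : Z →L[ℝ] Z :=
  ContinuousLinearMap.id ℝ Z + (t - 1) • P

theorem contraction_apply (P : Z →L[ℝ] Z) (t : ℝ) (z : Z) :
    contraction P t z = z + (t - 1) • P z := rfl

@[simp] theorem contraction_one (P : Z →L[ℝ] Z) (z : Z) : contraction P 1 z = z := by
  simp [contraction_apply]

theorem contDiff_contraction (P : Z →L[ℝ] Z) {n : WithTop ℕ∞} :
    ContDiff ℝ n fun y : Z × ℝ => contraction P y.2 y.1 := by
  simp only [contraction_apply]
  fun_prop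

/-- The integrand of the homotopy operator. -/
def homotopyIntegrand (P : Z →L[ℝ] Z) (η : Z → Z [⋀^Fin (p + 1)]→L[ℝ] ℝ) (y : Z × ℝ) :
    Z [⋀^Fin p]→L[ℝ] ℝ :=
  ((η (contraction P y.2 y.1)).curryLeft (P y.1)).compContinuousLinearMap (contraction P y.2)

/-- The homotopy operator of the contraction onto the kernel of the projection `P`. -/
def homotopyOp (P : Z →L[ℝ] Z) (η : Z → Z [⋀^Fin (p + 1)]→L[ℝ] ℝ) (z : Z) :
    Z [⋀^Fin p]→L[ℝ] ℝ :=
  ∫ t in (0 : ℝ)..1, homotopyIntegrand P η (z, t)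

theorem homotopyIntegrand_apply (P : Z →L[ℝ] Z) (η : Z → Z [⋀^Fin (p + 1)]→L[ℝ] ℝ) (y : Z × ℝ)
    (a : Fin p → Z) :
    homotopyIntegrand P η y a = η (contraction P y.2 y.1)
      (Fin.cons (P y.1) fun i => contraction P y.2 (a i)) := rfl

theorem hasDerivAt_contraction_apply (P : Z →L[ℝ] Z) (t : ℝ) (z : Z) :
    HasDerivAt (fun s => contraction P s z) (P z) t := by
  simp only [contraction_apply]
  simpa using (((hasDerivAt_id t).sub_const 1).smul_const (P z)).const_add z

theorem hasDerivAt_alternatingMap_contraction (P : Z →L[ℝ] Z) {η : Z → Z [⋀^Fin p]→L[ℝ] ℝ}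
    (hη : ContDiff ℝ ∞ η) (z : Z) (a : Fin p → Z) (t : ℝ) :
    HasDerivAt (fun s => η (contraction P s z) (fun i => contraction P s (a i)))
      (fderiv ℝ η (contraction P t z) (P z) (fun i => contraction P t (a i))
        + ∑ i, η (contraction P t z)
          (Function.update (fun j => contraction P t (a j)) i (P (a i)))) t := by
  have h1 := (hη.differentiable (by simp) (contraction P t z)).hasFDerivAt.comp_hasDerivAt t
    (hasDerivAt_contraction_apply P t z)
  have h2 := (h1.hasFDerivAt.continuousAlternatingMap_apply
    (g := fun i s => contraction P s (a i))
    fun i => (hasDerivAt_contraction_apply P t (a i)).hasFDerivAt).hasDerivAt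
  simpa using h2

theorem removeNth_succ_cons {α : Type*} (x : α) (b : Fin (p + 1) → α) (i : Fin (p + 1)) :
    i.succ.removeNth (Fin.cons (α := fun _ => α) x b) = Fin.cons (α := fun _ => α) x
      (i.removeNth b) := by
  funext j
  refine Fin.cases ?_ (fun j => ?_) j <;> simp [Fin.removeNth]

variable [FiniteDimensional ℝ Z]

theorem contDiff_homotopyIntegrand (P : Z →L[ℝ] Z) {η : Z → Z [⋀^Fin (p + 1)]→L[ℝ] ℝ}
    (hη : ContDiff ℝ ∞ η) : ContDiff ℝ ∞ (homotopyIntegrand P η) := by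
  refine contDiff_of_alternatingMap_apply fun v => ?_
  simp only [homotopyIntegrand_apply]
  refine contDiff_alternatingMap_apply
    (a := fun i (y : Z × ℝ) => Fin.cons (α := fun _ => Z) (P y.1)
      (fun j => contraction P y.2 (v j)) i)
    (hη.comp (contDiff_contraction P)) fun i => ?_
  refine Fin.cases ?_ (fun j => ?_) i
  · simp only [Fin.cons_zero]; fun_prop
  · simp only [Fin.cons_succ, contraction_apply]; fun_prop

theorem contDiff_homotopyOp (P : Z →L[ℝ] Z) {η : Z → Z [⋀^Fin (p + 1)]→L[ℝ] ℝ}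
    (hη : ContDiff ℝ ∞ η) : ContDiff ℝ ∞ (homotopyOp P η) :=
  have := FiniteDimensional.complete ℝ (Z [⋀^Fin p]→L[ℝ] ℝ)
  contDiff_parametric_intervalIntegral (contDiff_homotopyIntegrand P hη) 0 1

theorem homotopyOp_apply (P : Z →L[ℝ] Z) {η : Z → Z [⋀^Fin (p + 1)]→L[ℝ] ℝ}
    (hη : ContDiff ℝ ∞ η) (z : Z) (a : Fin p → Z) :
    homotopyOp P η z a = ∫ t in (0 : ℝ)..1, η (contraction P t z)
      (Fin.cons (P z) fun i => contraction P t (a i)) := by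
  have := FiniteDimensional.complete ℝ (Z [⋀^Fin p]→L[ℝ] ℝ)
  have hi : IntervalIntegrable (fun t => homotopyIntegrand P η (z, t)) MeasureTheory.volume 0 1 :=
    ((contDiff_homotopyIntegrand P hη).continuous.comp
      (by fun_prop : Continuous fun t : ℝ => (z, t))).intervalIntegrable _ _
  exact ((ContinuousAlternatingMap.apply ℝ Z ℝ a).intervalIntegral_comp_comm hi).symm

/-- The base point enters the integrand twice, through the coefficients of `η` and linearly through
the inserted vector `P z`; the two terms are those of the product rule along `s ↦ z + s • v`. -/
theorem fderiv_homotopyIntegrand_apply (P : Z →L[ℝ] Z) {η : Z → Z [⋀^Fin (p + 1)]→L[ℝ] ℝ}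
    (hη : ContDiff ℝ ∞ η) (z : Z) (t : ℝ) (v : Z) (a : Fin p → Z) :
    fderiv ℝ (homotopyIntegrand P η) (z, t) (v, 0) a
      = fderiv ℝ η (contraction P t z) (contraction P t v)
          (Fin.cons (P z) fun i => contraction P t (a i))
        + η (contraction P t z) (Fin.cons (P v) fun i => contraction P t (a i)) := by
  have hd := ((contDiff_homotopyIntegrand P hη).differentiable (by simp)) (z, t)
  have e0 : HasDerivAt (fun s : ℝ => z + s • v) v 0 := by
    simpa using ((hasDerivAt_id (0 : ℝ)).smul_const v).const_add z
  have e1 : HasDerivAt (fun s : ℝ => (z + s • v, t)) (v, 0) 0 :=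
    e0.prodMk (hasDerivAt_const _ _)
  have hd' : HasFDerivAt (homotopyIntegrand P η) (fderiv ℝ (homotopyIntegrand P η) (z, t))
      (z + (0 : ℝ) • v, t) := by simpa using hd.hasFDerivAt
  have e2 := (ContinuousAlternatingMap.apply ℝ Z ℝ a).hasFDerivAt.comp_hasDerivAt (0 : ℝ)
    (hd'.comp_hasDerivAt (0 : ℝ) e1)
  have d1 : HasFDerivAt η (fderiv ℝ η (contraction P t z))
      (contraction P t (z + (0 : ℝ) • v)) := by
    simpa using (hη.differentiable (by simp) (contraction P t z)).hasFDerivAt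
  have d2 := d1.comp_hasDerivAt (0 : ℝ)
    ((contraction P t).hasFDerivAt.comp_hasDerivAt (0 : ℝ) e0)
  let b : Z → Fin (p + 1) → Z := fun u => Fin.cons u fun i => contraction P t (a i)
  have d3 := (ContinuousAlternatingMap.apply ℝ Z ℝ (b (P z))).hasFDerivAt.comp_hasDerivAt
    (0 : ℝ) d2
  have d4 := (ContinuousAlternatingMap.apply ℝ Z ℝ (b (P v))).hasFDerivAt.comp_hasDerivAt
    (0 : ℝ) d2
  have d5 := d3.add ((hasDerivAt_id (0 : ℝ)).mul d4)
  have hfun : (ContinuousAlternatingMap.apply ℝ Z ℝ a ∘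
      homotopyIntegrand P η ∘ fun s : ℝ => (z + s • v, t)) = _ := funext fun s => by
    change η (contraction P t (z + s • v)) (b (P (z + s • v))) =
      η (contraction P t (z + s • v)) (b (P z)) + s * η (contraction P t (z + s • v)) (b (P v))
    have h : ∀ u, η (contraction P t (z + s • v)) (b u) =
      (η (contraction P t (z + s • v))).curryLeft u fun i => contraction P t (a i) := fun _ => rfl
    rw [h, h, h, map_add P, map_smul P, map_add (η _).curryLeft, map_smul (η _).curryLeft]
    rfl
  rw [hfun] at e2
  have := e2.unique d5
  simpa [b] using this

/-- Cartan's formula under the integral sign. When `extDerivAlong` is expanded with `P z` in front,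
the derivatives in the directions `P (a i)` cancel those of the coefficients of the integrand. The
rest is the `t`-derivative from `hasDerivAt_alternatingMap_contraction`; the sign `(-1)^i` is used
up in moving `P (a i)` from the front to slot `i`. -/
theorem extDerivAlong_homotopyIntegrand (P : Z →L[ℝ] Z) (hP : ∀ z, P (P z) = P z)
    {η : Z → Z [⋀^Fin (p + 1)]→L[ℝ] ℝ} (hη : ContDiff ℝ ∞ η) (z : Z) (t : ℝ)
    (a : Fin (p + 1) → Z) :
    (∑ i : Fin (p + 1), (-1 : ℝ) ^ (i : ℕ) *
        fderiv ℝ (homotopyIntegrand P η) (z, t) (P (a i), 0) (i.removeNth a))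
      + extDerivAlong P η (contraction P t z) (Fin.cons (P z) fun i => contraction P t (a i))
      = fderiv ℝ η (contraction P t z) (P z) (fun i => contraction P t (a i))
        + ∑ i, η (contraction P t z)
          (Function.update (fun j => contraction P t (a j)) i (P (a i))) := by
  have hc : ∀ u, contraction P t (P u) = P (contraction P t u) := fun u => by
    simp [contraction_apply]
  set A := fun i => contraction P t (a i) with hA
  set g := η (contraction P t z)
  set D := fderiv ℝ η (contraction P t z)
  have h0 : extDerivAlong P η (contraction P t z) (Fin.cons (P z) A)
      = D (P z) A - ∑ i : Fin (p + 1), (-1 : ℝ) ^ (i : ℕ) *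
        D (contraction P t (P (a i))) (Fin.cons (P z) (i.removeNth A)) := by
    have h := extDerivAlong_apply P η (contraction P t z) (Fin.cons (P z) A)
    rw [Fin.sum_univ_succ] at h
    simp only [Fin.cons_zero, Fin.val_zero, pow_zero, one_mul, Fin.cons_succ, Fin.val_succ, hP,
      removeNth_succ_cons] at h
    rw [h, sub_eq_add_neg, ← Finset.sum_neg_distrib]
    congr 1
    refine Finset.sum_congr rfl fun i _ => ?_
    rw [hc, pow_succ]
    ring
  have h1 : ∀ i : Fin (p + 1), fderiv ℝ (homotopyIntegrand P η) (z, t) (P (a i), 0) (i.removeNth a)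
      = D (contraction P t (P (a i))) (Fin.cons (P z) (i.removeNth A))
        + g (Fin.cons (P (a i)) (i.removeNth A)) := fun i => by
    rw [fderiv_homotopyIntegrand_apply P hη, hP]
    rfl
  have h2 : ∀ i : Fin (p + 1), (-1 : ℝ) ^ (i : ℕ) * g (Fin.cons (P (a i)) (i.removeNth A))
      = g (Function.update A i (P (a i))) := fun i => by
    rw [← Fin.insertNth_removeNth, ContinuousAlternatingMap.map_insertNth, zsmul_eq_mul]
    push_cast
    rfl
  simp only [h0, h1, h2, mul_add, Finset.sum_add_distrib]
  ring

/-- Homotopy formula for the contraction onto the kernel of a projection. -/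
theorem extDerivAlong_homotopyOp (P : Z →L[ℝ] Z) (hP : ∀ z, P (P z) = P z)
    {η : Z → Z [⋀^Fin (p + 1)]→L[ℝ] ℝ} (hη : ContDiff ℝ ∞ η) (z : Z) (a : Fin (p + 1) → Z)
    (hz : ∀ t ∈ Set.Icc (0 : ℝ) 1, extDerivAlong P η (contraction P t z)
      (Fin.cons (P z) fun i => contraction P t (a i)) = 0) :
    extDerivAlong P (homotopyOp P η) z a
      = η z a - η (contraction P 0 z) (fun i => contraction P 0 (a i)) := by
  have := FiniteDimensional.complete ℝ (Z [⋀^Fin p]→L[ℝ] ℝ)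
  have hJ := contDiff_homotopyIntegrand P hη
  have hJ' : Continuous (fderiv ℝ (homotopyIntegrand P η)) := hJ.continuous_fderiv (by simp)
  have hc : Continuous fun t : ℝ => (z, t) := by fun_prop
  have hfd : ∀ (v : Z) (b : Fin p → Z), fderiv ℝ (homotopyOp P η) z v b
      = ∫ t in (0 : ℝ)..1, fderiv ℝ (homotopyIntegrand P η) (z, t) (v, 0) b := by
    intro v b
    have hcont : Continuous fun t : ℝ => (fderiv ℝ (homotopyIntegrand P η) (z, t)).comp
        (ContinuousLinearMap.inl ℝ Z ℝ) := (hJ'.comp hc).clm_comp continuous_const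
    have hcont' : Continuous fun t : ℝ => ((fderiv ℝ (homotopyIntegrand P η) (z, t)).comp
        (ContinuousLinearMap.inl ℝ Z ℝ)) v := hcont.clm_apply continuous_const
    have h := hasFDerivAt_parametric_intervalIntegral (hJ.of_le (by simp)) 0 1 z
    rw [show fderiv ℝ (homotopyOp P η) z = _ from h.fderiv,
      ContinuousLinearMap.intervalIntegral_apply (hcont.intervalIntegrable _ _)]
    exact ((ContinuousAlternatingMap.apply ℝ Z ℝ b).intervalIntegral_comp_comm
      (hcont'.intervalIntegrable _ _)).symm
  have hcs : ∀ i : Fin (p + 1), Continuous fun t : ℝ => (-1 : ℝ) ^ (i : ℕ) *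
      fderiv ℝ (homotopyIntegrand P η) (z, t) (P (a i), 0) (i.removeNth a) := fun i =>
    continuous_const.mul ((ContinuousAlternatingMap.apply ℝ Z ℝ (i.removeNth a)).continuous.comp
      ((hJ'.comp hc).clm_apply continuous_const))
  rw [extDerivAlong_apply]
  simp only [hfd, ← intervalIntegral.integral_const_mul]
  rw [← intervalIntegral.integral_finsetSum fun i _ => (hcs i).intervalIntegrable _ _]
  -- Closedness along the contraction segment turns the integrand into an exact `t`-derivative, so
  -- only the values at `1` and `0` remain.
  have hint := intervalIntegral.integral_eq_sub_of_hasDerivAt (a := (0 : ℝ)) (b := 1)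
    (f := fun s => η (contraction P s z) (fun i => contraction P s (a i)))
    (f' := fun t => ∑ i : Fin (p + 1), (-1 : ℝ) ^ (i : ℕ) *
      fderiv ℝ (homotopyIntegrand P η) (z, t) (P (a i), 0) (i.removeNth a)) (fun t ht => by
        have h := hasDerivAt_alternatingMap_contraction P hη z a t
        rw [← extDerivAlong_homotopyIntegrand P hP hη,
          hz t (by rwa [Set.uIcc_of_le zero_le_one] at ht), add_zero] at h
        exact h)
    ((continuous_finsetSum _ fun i _ => hcs i).intervalIntegrable _ _)
  simpa using hint

end PartialDeriv

/-! ### Finite-order coordinate spaces and the Cartan term. -/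

section CoordSpace

variable {E : Type*} [NormedAddCommGroup E] [NormedSpace ℝ E]
  {F : Type*} [NormedAddCommGroup F] [NormedSpace ℝ F]

instance finiteDimensional_coordSpace [FiniteDimensional ℝ E] [FiniteDimensional ℝ F] (r : ℕ) :
    FiniteDimensional ℝ (CoordSpace E F r) :=
  inferInstanceAs (FiniteDimensional ℝ (E × (∀ k : Fin (r + 1), E [×(k : ℕ)]→L[ℝ] F)))

/-- The projection `(x^λ, y^i_Λ) ↦ (0, y^i_Λ)`. -/
def vertProj (E F : Type*) [NormedAddCommGroup E] [NormedSpace ℝ E]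
    [NormedAddCommGroup F] [NormedSpace ℝ F] (r : ℕ) :
    CoordSpace E F r →L[ℝ] CoordSpace E F r :=
  (0 : E × (∀ k : Fin (r + 1), E [×(k : ℕ)]→L[ℝ] F) →L[ℝ] E).prod
    (ContinuousLinearMap.snd ℝ E (∀ k : Fin (r + 1), E [×(k : ℕ)]→L[ℝ] F))

theorem vertProj_vertProj (r : ℕ) (c : CoordSpace E F r) :
    vertProj E F r (vertProj E F r c) = vertProj E F r c := rfl

theorem CoordSpace.ext_coord {r : ℕ} {c c' : CoordSpace E F r} (h1 : c.1 = c'.1)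
    (h2 : ∀ k, c.2 k = c'.2 k) : c = c' :=
  Prod.ext h1 (funext h2)

/-- The vector `y^i_{λ+Λ} a^λ`, for `c = (x^λ, y^i_Λ)` and a tangent vector `a`. -/
def cartanTerm (r : ℕ) (c : CoordSpace E F (r + 1)) :
    CoordSpace E F (r + 1) →L[ℝ] CoordSpace E F r :=
  (0 : E × (∀ k : Fin (r + 2), E [×(k : ℕ)]→L[ℝ] F) →L[ℝ] E).prod
    (ContinuousLinearMap.pi fun k : Fin (r + 1) =>
      (ContinuousMultilinearMap.curryLeft (n := k) (Ei := fun _ => E) (c.2 k.succ)) ∘L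
        ContinuousLinearMap.fst ℝ E (∀ k : Fin (r + 2), E [×(k : ℕ)]→L[ℝ] F))

theorem contDiff_curryLeft_apply {k : ℕ} {n : WithTop ℕ∞} (w : E) :
    ContDiff ℝ n fun g : E [×(k + 1)]→L[ℝ] F => g.curryLeft w := by
  refine IsBoundedLinearMap.contDiff (IsLinearMap.with_bound ⟨fun _ _ => rfl, fun _ _ => rfl⟩ ‖w‖
    fun g => ?_)
  rw [mul_comm, ← g.curryLeft_norm]
  exact ContinuousLinearMap.le_opNorm _ _

theorem contDiff_cartanTerm (r : ℕ) {n : WithTop ℕ∞} (a : CoordSpace E F (r + 1)) :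
    ContDiff ℝ n fun c : CoordSpace E F (r + 1) => cartanTerm r c a := by
  have h : ∀ k : Fin (r + 1), ContDiff ℝ n
      fun c : E × (∀ k : Fin (r + 2), E [×(k : ℕ)]→L[ℝ] F) =>
        (ContinuousMultilinearMap.curryLeft (n := k) (Ei := fun _ => E) (c.2 k.succ)) a.1 := by
    intro k
    have h1 : ContDiff ℝ n
        fun c : E × (∀ k : Fin (r + 2), E [×(k : ℕ)]→L[ℝ] F) => c.2 k.succ :=
      ((ContinuousLinearMap.proj (R := ℝ) (φ := fun k : Fin (r + 2) => E [×(k : ℕ)]→L[ℝ] F)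
        k.succ) ∘L ContinuousLinearMap.snd ℝ E _).contDiff
    exact (contDiff_curryLeft_apply a.1).comp h1
  exact contDiff_const.prodMk (contDiff_pi.2 h)

/-- A form on the order-`r` coordinate space, pulled back to order `r + 1` after adding `s` times
the Cartan term to every vector. -/
def cartanShift {p r : ℕ} (s : ℝ)
    (η : CoordSpace E F r → CoordSpace E F r [⋀^Fin p]→L[ℝ] ℝ) (c : CoordSpace E F (r + 1)) :
    CoordSpace E F (r + 1) [⋀^Fin p]→L[ℝ] ℝ :=
  (η (coordTrunc E F r.le_succ c)).compContinuousLinearMap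
    (coordTrunc E F r.le_succ + s • cartanTerm r c)

theorem contDiffOn_cartanShift [FiniteDimensional ℝ E] [FiniteDimensional ℝ F] {p r : ℕ} (s : ℝ)
    {η : CoordSpace E F r → CoordSpace E F r [⋀^Fin p]→L[ℝ] ℝ} {W : Set (CoordSpace E F r)}
    (hη : ContDiffOn ℝ ∞ η W) :
    ContDiffOn ℝ ∞ (cartanShift s η) (coordTrunc E F r.le_succ ⁻¹' W) := by
  refine contDiffOn_of_alternatingMap_apply fun v => ?_
  refine contDiffOn_alternatingMap_apply
    (f := fun c => η (coordTrunc E F r.le_succ c))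
    (a := fun i c => coordTrunc E F r.le_succ (v i) + s • cartanTerm r c (v i)) ?_ fun i => ?_
  · exact hη.comp (coordTrunc E F r.le_succ).contDiff.contDiffOn fun _ h => h
  · have h : ContDiff ℝ ∞ fun c => s • cartanTerm r c (v i) :=
      (contDiff_cartanTerm r (v i)).const_smul s
    exact (contDiff_const.add h).contDiffOn

end CoordSpace

/-! ### Coefficients of forms in the generators `dx^λ`, `θ^i_Λ`. -/

section Jets

variable {E : Type*} [NormedAddCommGroup E] [NormedSpace ℝ E]
  {X : Type*} [TopologicalSpace X] [ChartedSpace E X] [IsManifold 𝓘(ℝ, E) ∞ X]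
  {F : Type*} [NormedAddCommGroup F] [NormedSpace ℝ F]
  {Y : X → Type*} [TopologicalSpace (TotalSpace F Y)]
  [∀ x, AddCommGroup (Y x)] [∀ x, Module ℝ (Y x)] [∀ x, TopologicalSpace (Y x)]
  [FiberBundle F Y] [VectorBundle ℝ F Y] [ContMDiffVectorBundle ∞ F Y 𝓘(ℝ, E)]

/-- The values of the forms `dx^λ` and `θ^i_Λ`, `|Λ| ≤ r`, on a tangent vector. -/
def frame (r : ℕ) (x₀ : X) (q : JetSpace E F Y) (hq : q.1 ∈ chartDom (E := E) F Y x₀)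
    (ξ : TangentJet q) : CoordSpace E F r :=
  (baseCoordDiff x₀ q.1 ξ.1, fun k => jetCoord F Y x₀ q.1 hq k ξ.2)

theorem coordDiff_eq (r : ℕ) (x₀ : X) (q : JetSpace E F Y)
    (hq : q.1 ∈ chartDom (E := E) F Y x₀) (ξ : TangentJet q) :
    coordDiff r x₀ q hq ξ = coordTrunc E F r.le_succ (frame (r + 1) x₀ q hq ξ)
      + cartanTerm r (coord (r + 1) x₀ q hq) (frame (r + 1) x₀ q hq ξ) :=
  CoordSpace.ext_coord (add_zero _).symm fun _ => rfl

/-- The Cartan term sees only the base component of a vector, which `frame` and `coordDiff` share,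
so flipping its sign inverts the change of generators. -/
theorem frame_eq (r : ℕ) (x₀ : X) (q : JetSpace E F Y)
    (hq : q.1 ∈ chartDom (E := E) F Y x₀) (ξ : TangentJet q) :
    frame r x₀ q hq ξ = coordTrunc E F r.le_succ (coordDiff (r + 1) x₀ q hq ξ)
      - cartanTerm r (coord (r + 1) x₀ q hq) (coordDiff (r + 1) x₀ q hq ξ) :=
  CoordSpace.ext_coord (sub_zero _).symm fun _ => (add_sub_cancel_right _ _).symm

/-- On jets with coordinates in `W`, the form `φ` has the coefficients `η` with respect to the
generators `dx^λ`, `θ^i_Λ` of the bundle chart around `x₀`. -/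
def IsFrameRepr {p r : ℕ} (φ : PreForm E F Y p) (x₀ : X) (W : Set (CoordSpace E F r))
    (η : CoordSpace E F r → CoordSpace E F r [⋀^Fin p]→L[ℝ] ℝ) : Prop :=
  ∀ (q : JetSpace E F Y) (hq : q.1 ∈ chartDom (E := E) F Y x₀),
    coord r x₀ q hq ∈ W → ∀ ξ : Fin p → TangentJet q,
      φ q ξ = η (coord r x₀ q hq) (fun i => frame r x₀ q hq (ξ i))

/-- Substituting `dy^i_Λ = θ^i_Λ + y^i_{λ+Λ} dx^λ` brings in coordinates one order higher, hence the
passage from `r` to `r + 1`. -/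
theorem IsLocPullback.exists_frameRepr [FiniteDimensional ℝ E] [FiniteDimensional ℝ F]
    {p : ℕ} {φ : PreForm E F Y p} (hφ : IsLocPullback φ) (q₀ : JetSpace E F Y) :
    ∃ (r : ℕ) (W : Set (CoordSpace E F r)), IsOpen W ∧
      coord r q₀.1 q₀ (mem_chartDom_self F Y q₀.1) ∈ W ∧
      ∃ η : CoordSpace E F r → CoordSpace E F r [⋀^Fin p]→L[ℝ] ℝ,
        ContDiffOn ℝ ∞ η W ∧ IsFrameRepr φ q₀.1 W η := by
  obtain ⟨r, W, hW, hq₀, η, hη, h⟩ := hφ q₀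
  refine ⟨r + 1, coordTrunc E F r.le_succ ⁻¹' W, hW.preimage (coordTrunc E F _).continuous, hq₀,
    cartanShift 1 η, contDiffOn_cartanShift 1 hη, fun q hq hqW ξ => ?_⟩
  rw [h q hq hqW ξ]
  simp only [coordDiff_eq, cartanShift, one_smul]
  rfl

theorem isLocPullback_of_frameRepr [FiniteDimensional ℝ E] [FiniteDimensional ℝ F]
    {p : ℕ} {φ : PreForm E F Y p} (hφ : ∀ q₀ : JetSpace E F Y,
      ∃ (r : ℕ) (W : Set (CoordSpace E F r)), IsOpen W ∧
      coord r q₀.1 q₀ (mem_chartDom_self F Y q₀.1) ∈ W ∧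
      ∃ η : CoordSpace E F r → CoordSpace E F r [⋀^Fin p]→L[ℝ] ℝ,
        ContDiffOn ℝ ∞ η W ∧ IsFrameRepr φ q₀.1 W η) : IsLocPullback φ := by
  intro q₀
  obtain ⟨r, W, hW, hq₀, η, hη, h⟩ := hφ q₀
  refine ⟨r + 1, coordTrunc E F r.le_succ ⁻¹' W, hW.preimage (coordTrunc E F _).continuous, hq₀,
    cartanShift (-1) η, contDiffOn_cartanShift (-1) hη, fun q hq hqW ξ => ?_⟩
  rw [h q hq hqW ξ]
  simp only [frame_eq, cartanShift, neg_smul, one_smul, ← sub_eq_add_neg]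
  rfl

theorem coord_smul (r : ℕ) (x₀ : X) (q : JetSpace E F Y)
    (hq : q.1 ∈ chartDom (E := E) F Y x₀) (t : ℝ) :
    coord r x₀ ⟨q.1, t • q.2⟩ hq = contraction (vertProj E F r) t (coord r x₀ q hq) := by
  refine CoordSpace.ext_coord ?_ fun k => ?_
  · change extChartAt 𝓘(ℝ, E) x₀ q.1 = extChartAt 𝓘(ℝ, E) x₀ q.1 + (t - 1) • (0 : E)
    simp
  · change jetCoord F Y x₀ q.1 hq k (t • q.2) = jetCoord F Y x₀ q.1 hq k q.2
      + (t - 1) • jetCoord F Y x₀ q.1 hq k q.2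
    rw [map_smul]
    module

theorem frame_smul (r : ℕ) (x₀ : X) (q : JetSpace E F Y)
    (hq : q.1 ∈ chartDom (E := E) F Y x₀) (t : ℝ) (ξ : TangentJet q) :
    frame r x₀ q hq (ξ.1, t • ξ.2) = contraction (vertProj E F r) t (frame r x₀ q hq ξ) := by
  refine CoordSpace.ext_coord ?_ fun k => ?_
  · change baseCoordDiff x₀ q.1 ξ.1 = baseCoordDiff x₀ q.1 ξ.1 + (t - 1) • (0 : E)
    simp
  · change jetCoord F Y x₀ q.1 hq k (t • ξ.2) = jetCoord F Y x₀ q.1 hq k ξ.2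
      + (t - 1) • jetCoord F Y x₀ q.1 hq k ξ.2
    rw [map_smul]
    module

theorem frame_radial (r : ℕ) (x₀ : X) (q : JetSpace E F Y)
    (hq : q.1 ∈ chartDom (E := E) F Y x₀) :
    frame r x₀ q hq (0, q.2) = vertProj E F r (coord r x₀ q hq) :=
  CoordSpace.ext_coord (map_zero _) fun _ => rfl

theorem coord_add_smul (r : ℕ) (x₀ : X) (q : JetSpace E F Y)
    (hq : q.1 ∈ chartDom (E := E) F Y x₀) (t : ℝ) (ξ : TangentJet q) :
    coord r x₀ ⟨q.1, q.2 + t • ξ.2⟩ hq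
      = coord r x₀ q hq + t • vertProj E F r (frame r x₀ q hq ξ) := by
  refine CoordSpace.ext_coord ?_ fun k => ?_
  · change extChartAt 𝓘(ℝ, E) x₀ q.1 = extChartAt 𝓘(ℝ, E) x₀ q.1 + t • (0 : E)
    simp
  · change jetCoord F Y x₀ q.1 hq k (q.2 + t • ξ.2) = jetCoord F Y x₀ q.1 hq k q.2
      + t • jetCoord F Y x₀ q.1 hq k ξ.2
    rw [map_add, map_smul]

/-- Motion along the fibre fixes the values of the generators, which depend only on the base point
and the vector, and moves the coordinates on a straight line that stays in the open set `W` for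
small `t`. -/
theorem IsFrameRepr.hasDerivAt {p r : ℕ} {φ : PreForm E F Y p} {x₀ : X}
    {W : Set (CoordSpace E F r)} {η : CoordSpace E F r → CoordSpace E F r [⋀^Fin p]→L[ℝ] ℝ}
    (h : IsFrameRepr φ x₀ W η) (hW : IsOpen W) (hη : ContDiffOn ℝ ∞ η W)
    (q : JetSpace E F Y) (hq : q.1 ∈ chartDom (E := E) F Y x₀) (hqW : coord r x₀ q hq ∈ W)
    (ξ : TangentJet q) (b : Fin p → TangentJet q) :
    HasDerivAt (fun t : ℝ => φ ⟨q.1, q.2 + t • ξ.2⟩ b)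
      (fderiv ℝ η (coord r x₀ q hq) (vertProj E F r (frame r x₀ q hq ξ))
        (fun i => frame r x₀ q hq (b i))) 0 := by
  set c := coord r x₀ q hq
  set v := vertProj E F r (frame r x₀ q hq ξ)
  have hc : HasDerivAt (fun t : ℝ => c + t • v) v 0 := by
    simpa using ((hasDerivAt_id (0 : ℝ)).smul_const v).const_add c
  have hd : HasFDerivAt η (fderiv ℝ η c) (c + (0 : ℝ) • v) := by
    simpa using ((hη.contDiffAt (hW.mem_nhds hqW)).differentiableAt (by simp)).hasFDerivAt
  have h1 := (ContinuousAlternatingMap.apply ℝ (CoordSpace E F r) ℝ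
    (fun i => frame r x₀ q hq (b i))).hasFDerivAt.comp_hasDerivAt (0 : ℝ)
      (hd.comp_hasDerivAt (0 : ℝ) hc)
  refine h1.congr_of_eventuallyEq ?_
  have hmem : ∀ᶠ t : ℝ in 𝓝 0, c + t • v ∈ W :=
    hc.continuousAt.eventually_mem (hW.mem_nhds (by simpa using hqW))
  filter_upwards [hmem] with t ht
  have e := coord_add_smul r x₀ q hq t ξ
  have h2 := h ⟨q.1, q.2 + t • ξ.2⟩ hq (by rw [e]; exact ht) b
  rw [e] at h2
  exact h2

/-! ### The vertical differential on locally pull-back and contact forms. -/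

theorem IsFrameRepr.vertDiff {p r : ℕ} {φ : PreForm E F Y p} {x₀ : X}
    {W : Set (CoordSpace E F r)} {η : CoordSpace E F r → CoordSpace E F r [⋀^Fin p]→L[ℝ] ℝ}
    (h : IsFrameRepr φ x₀ W η) (hW : IsOpen W) (hη : ContDiffOn ℝ ∞ η W) :
    IsFrameRepr (vertDiff φ) x₀ W (extDerivAlong (vertProj E F r) η) := by
  intro q hq hqW ξ
  rw [extDerivAlong_apply]
  refine Finset.sum_congr rfl fun i _ => ?_
  rw [(h.hasDerivAt hW hη q hq hqW (ξ i) _).deriv]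
  rfl

theorem IsLocPullback.differentiableAt [FiniteDimensional ℝ E] [FiniteDimensional ℝ F]
    {p : ℕ} {φ : PreForm E F Y p} (hφ : IsLocPullback φ) (q : JetSpace E F Y)
    (v : JetInf E F Y q.1) (b : Fin p → TangentJet q) :
    DifferentiableAt ℝ (fun t : ℝ => φ ⟨q.1, q.2 + t • v⟩ b) 0 := by
  obtain ⟨r, W, hW, hqW, η, hη, h⟩ := hφ.exists_frameRepr q
  exact (h.hasDerivAt hW hη q _ hqW (0, v) b).differentiableAt

theorem IsLocPullback.vertDiff [FiniteDimensional ℝ E] [FiniteDimensional ℝ F]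
    {p : ℕ} {φ : PreForm E F Y p} (hφ : IsLocPullback φ) : IsLocPullback (vertDiff φ) := by
  refine isLocPullback_of_frameRepr fun q₀ => ?_
  obtain ⟨r, W, hW, hqW, η, hη, h⟩ := hφ.exists_frameRepr q₀
  exact ⟨r, W, hW, hqW, _, contDiffOn_extDerivAlong _ hW hη, h.vertDiff hW hη⟩

theorem IsLocPullback.vertDiff_vertDiff [FiniteDimensional ℝ E] [FiniteDimensional ℝ F]
    {p : ℕ} {φ : PreForm E F Y p} (hφ : IsLocPullback φ) :
    JetForms.vertDiff (JetForms.vertDiff φ) = 0 := by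
  funext q ξ
  obtain ⟨r, W, hW, hqW, η, hη, h⟩ := hφ.exists_frameRepr q
  rw [(h.vertDiff hW hη).vertDiff hW (contDiffOn_extDerivAlong _ hW hη) q _ hqW ξ,
    extDerivAlong_extDerivAlong _ hW hη hqW]
  rfl

/-- Deleting a vertical argument lowers the vertical count by one, so that summand differentiates a
function vanishing on the whole fibre line. Deleting a horizontal argument means differentiating in
the zero direction. -/
theorem IsContact.vertDiff {p k : ℕ} {φ : PreForm E F Y p} (hφ : IsContact k φ) :
    IsContact (k + 1) (vertDiff φ) := by
  classical
  intro q ξ S hS hS' hcard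
  refine Finset.sum_eq_zero fun i _ => ?_
  by_cases hi : i ∈ S
  · let S' : Finset (Fin p) := Finset.univ.filter fun j => i.succAbove j ∈ S
    have hS'' : S = insert i (S'.map i.succAboveEmb) := by
      ext j
      refine Fin.succAboveCases i ?_ (fun j => ?_) j
      · simp [hi]
      · simp [S', Fin.succAbove_ne]
    have hc : S'.card ≠ k := by
      intro h
      apply hcard
      rw [hS'', Finset.card_insert_of_notMem (by simp), Finset.card_map, h]
    have hz : (fun t : ℝ => φ ⟨q.1, q.2 + t • (ξ i).2⟩ fun j => ξ (i.succAbove j)) = fun _ => 0 :=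
      funext fun t => hφ ⟨q.1, q.2 + t • (ξ i).2⟩ (fun j => ξ (i.succAbove j)) S'
        (fun j hj => hS _ (by simpa [S'] using hj)) (fun j hj => hS' _ (by simpa [S'] using hj)) hc
    rw [hz, deriv_const, mul_zero]
  · have hz : (fun t : ℝ => φ ⟨q.1, q.2 + t • (ξ i).2⟩ fun j => ξ (i.succAbove j))
        = fun _ => φ q fun j => ξ (i.succAbove j) := funext fun t => by
      have e : q.2 + t • (ξ i).2 = q.2 := by rw [hS' i hi, smul_zero, add_zero]
      exact congrArg (fun v : JetInf E F Y q.1 => φ ⟨q.1, v⟩ fun j => ξ (i.succAbove j)) e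
    rw [hz, deriv_const, mul_zero]

theorem IsLocPullback.vertDiff_add [FiniteDimensional ℝ E] [FiniteDimensional ℝ F]
    {p : ℕ} {φ ψ : PreForm E F Y p} (hφ : IsLocPullback φ) (hψ : IsLocPullback ψ) :
    JetForms.vertDiff (φ + ψ) = JetForms.vertDiff φ + JetForms.vertDiff ψ := by
  funext q ξ
  simp only [JetForms.vertDiff, Pi.add_apply, ← Finset.sum_add_distrib, ← mul_add]
  refine Finset.sum_congr rfl fun i _ => ?_
  rw [deriv_fun_add (hφ.differentiableAt q _ _) (hψ.differentiableAt q _ _)]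

theorem IsLocPullback.vertDiff_smul [FiniteDimensional ℝ E] [FiniteDimensional ℝ F]
    {p : ℕ} {φ : PreForm E F Y p} (hφ : IsLocPullback φ) (c : ℝ) :
    JetForms.vertDiff (c • φ) = c • JetForms.vertDiff φ := by
  funext q ξ
  simp only [JetForms.vertDiff, Pi.smul_apply, smul_eq_mul, Finset.mul_sum]
  refine Finset.sum_congr rfl fun i _ => ?_
  rw [deriv_const_mul _ (hφ.differentiableAt q _ _), mul_left_comm]

/-- The vertical differential on `Q^{k,m}_∞`. -/
def vertDiffLinear [FiniteDimensional ℝ E] [FiniteDimensional ℝ F] (k m : ℕ) :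
    contactForms E F Y k m →ₗ[ℝ] contactForms E F Y (k + 1) m where
  toFun φ := ⟨vertDiff φ.1, φ.2.1.vertDiff, φ.2.2.vertDiff⟩
  map_add' φ ψ := Subtype.ext (φ.2.1.vertDiff_add ψ.2.1)
  map_smul' c φ := Subtype.ext (φ.2.1.vertDiff_smul c)

/-! ### The homotopy operator on jets. -/

/-- Along the segment joining a jet to the zero jet, a locally pull-back form is the pull-back of a
single smooth form on a coordinate space of finite order. -/
theorem IsLocPullback.exists_frameRepr_segment [FiniteDimensional ℝ E] [FiniteDimensional ℝ F]
    {p : ℕ} {φ : PreForm E F Y p} (hφ : IsLocPullback φ) (q₀ : JetSpace E F Y) :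
    ∃ (r : ℕ) (O : Set (CoordSpace E F r)), IsOpen O ∧
      (∃ η : CoordSpace E F r → CoordSpace E F r [⋀^Fin p]→L[ℝ] ℝ,
        ContDiff ℝ ∞ η ∧ IsFrameRepr φ q₀.1 O η) ∧
      ∃ W : Set (CoordSpace E F r), IsOpen W ∧
        coord r q₀.1 q₀ (mem_chartDom_self F Y q₀.1) ∈ W ∧
        ∀ c ∈ W, ∀ t ∈ Set.Icc (0 : ℝ) 1, contraction (vertProj E F r) t c ∈ O := by
  have hx := mem_chartDom_self (E := E) F Y q₀.1
  -- All the jets `t • q₀.2` lie over one point, so every representative uses the same bundle chart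
  -- and only the order `r t` varies.
  choose r W hW hmem η hη hrep using fun t : ℝ =>
    hφ.exists_frameRepr (⟨q₀.1, t • q₀.2⟩ : JetSpace E F Y)
  have hcont : ∀ k, Continuous fun s : ℝ =>
      contraction (vertProj E F k) s (coord k q₀.1 q₀ hx) := fun k => by
    simp only [contraction_apply]; fun_prop
  have hV : ∀ t, IsOpen {s : ℝ | contraction (vertProj E F (r t)) s (coord (r t) q₀.1 q₀ hx) ∈ W t} :=
    fun t => (hW t).preimage (hcont _)
  obtain ⟨T, hT⟩ := (isCompact_Icc (a := (0 : ℝ)) (b := 1)).elim_finite_subcover _ hV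
    (fun t _ => Set.mem_iUnion.2 ⟨t, by
      have h := hmem t
      rwa [coord_smul (r t) q₀.1 q₀ hx t] at h⟩)
  let R := T.sup r
  have hR : ∀ t ∈ T, r t ≤ R := fun t ht => Finset.le_sup ht
  let Ω : Set (CoordSpace E F R) := {c | ∃ (t : ℝ) (ht : t ∈ T), coordTrunc E F (hR t ht) c ∈ W t}
  have hΩ : IsOpen Ω := by
    have : Ω = ⋃ (t : ℝ) (ht : t ∈ T), coordTrunc E F (hR t ht) ⁻¹' W t := by
      ext c; simp [Ω]
    rw [this]
    exact isOpen_iUnion fun t => isOpen_iUnion fun ht =>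
      (hW t).preimage (coordTrunc E F (hR t ht)).continuous
  let c₀ := coord R q₀.1 q₀ hx
  have hseg : (fun s : ℝ => contraction (vertProj E F R) s c₀) '' Set.Icc 0 1 ⊆ Ω := by
    rintro _ ⟨s, hs, rfl⟩
    obtain ⟨t, ht, hst⟩ := Set.mem_iUnion₂.1 (hT hs)
    exact ⟨t, ht, hst⟩
  -- Representing `φ` is demanded only on the compact set `K`. Outside `Ω` the zero form is then
  -- locally admissible, and the patched form is smooth on the entire coordinate space.
  obtain ⟨K, hK, hsegK, hKΩ⟩ := exists_compact_between (isCompact_Icc.image (hcont R)) hΩ hseg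
  -- Representing `φ` at a point is an affine condition on `g`, so it survives the convex
  -- combinations of a partition of unity.
  have hconv : ∀ c : CoordSpace E F R, Convex ℝ {g : CoordSpace E F R [⋀^Fin p]→L[ℝ] ℝ |
      c ∈ K → ∀ (q : JetSpace E F Y) (hq : q.1 ∈ chartDom (E := E) F Y q₀.1),
        coord R q₀.1 q hq = c → ∀ ξ : Fin p → TangentJet q,
          φ q ξ = g (fun i => frame R q₀.1 q hq (ξ i))} := by
    intro c g hg g' hg' a b _ _ hab hc q hq hqc ξ
    change φ q ξ = a * g _ + b * g' _
    rw [← hg hc q hq hqc ξ, ← hg' hc q hq hqc ξ, ← add_mul, hab, one_mul]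
  obtain ⟨g, hg⟩ := exists_contMDiffMap_forall_mem_convex_of_local (n := ⊤)
    𝓘(ℝ, CoordSpace E F R) hconv (by
      intro c
      by_cases hc : c ∈ Ω
      · obtain ⟨t, ht, hct⟩ := hc
        have ho := (hW t).preimage (coordTrunc E F (hR t ht)).continuous
        refine ⟨_, ho.mem_nhds hct, fun c => (η t (coordTrunc E F (hR t ht) c)).compContinuousLinearMap
          (coordTrunc E F (hR t ht)), ?_, ?_⟩
        · rw [contMDiffOn_iff_contDiffOn]
          exact (ContinuousAlternatingMap.compContinuousLinearMapCLM
            (coordTrunc E F (hR t ht))).contDiff.comp_contDiffOn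
            ((hη t).comp (coordTrunc E F (hR t ht)).contDiff.contDiffOn fun _ h => h)
        · rintro c' hc' - q hq rfl ξ
          exact hrep t q hq hc' ξ
      · exact ⟨Kᶜ, hK.isClosed.isOpen_compl.mem_nhds fun h => hc (hKΩ h), fun _ => 0,
          contMDiffOn_const, fun c' hc' h => absurd h hc'⟩)
  -- By compactness of `[0, 1]`, the segments of all points near `c₀` also stay inside the interior
  -- of `K`.
  obtain ⟨u, v, hu, hv, hcu, htv, huv⟩ := generalized_tube_lemma (isCompact_singleton (x := c₀))
    (isCompact_Icc (a := (0 : ℝ)) (b := 1))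
    ((isOpen_interior (s := K)).preimage
      (contDiff_contraction (vertProj E F R) (n := 0)).continuous)
    (by
      rintro ⟨c, t⟩ ⟨rfl : c = c₀, ht⟩
      exact hsegK ⟨t, ht, rfl⟩)
  exact ⟨R, interior K, isOpen_interior, ⟨g, g.contMDiff.contDiff, fun q hq hqK ξ =>
    hg _ (interior_subset hqK) q hq rfl ξ⟩, u, hu, hcu rfl, fun c hc t ht =>
    huv (Set.mk_mem_prod hc (htv ht))⟩

/-- The homotopy operator of the fibrewise contraction of `J^∞ Y` onto the zero section. -/
def homotopyForm {p : ℕ} (φ : PreForm E F Y (p + 1)) : PreForm E F Y p :=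
  fun q ξ => ∫ t in (0 : ℝ)..1, φ ⟨q.1, t • q.2⟩
    (Fin.cons (α := fun _ => TangentJet q) (0, q.2) fun i => ((ξ i).1, t • (ξ i).2))

/-- This matches the arguments of `homotopyForm`, the radial vertical vector and the contracted
vectors, with those of `homotopyIntegrand`. -/
theorem frame_cons {p : ℕ} (r : ℕ) (x₀ : X) (q : JetSpace E F Y)
    (hq : q.1 ∈ chartDom (E := E) F Y x₀) (t : ℝ) (ξ : Fin p → TangentJet q) :
    (fun i => frame r x₀ q hq (Fin.cons (α := fun _ => TangentJet q) (0, q.2)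
      (fun i => ((ξ i).1, t • (ξ i).2)) i))
      = Fin.cons (vertProj E F r (coord r x₀ q hq))
        fun i => contraction (vertProj E F r) t (frame r x₀ q hq (ξ i)) := by
  funext i
  refine Fin.cases ?_ (fun i => ?_) i
  · exact frame_radial r x₀ q hq
  · exact frame_smul r x₀ q hq t (ξ i)

theorem IsFrameRepr.apply_smul {p r : ℕ} {φ : PreForm E F Y p} {x₀ : X}
    {O : Set (CoordSpace E F r)} {η : CoordSpace E F r → CoordSpace E F r [⋀^Fin p]→L[ℝ] ℝ}
    (h : IsFrameRepr φ x₀ O η) (q : JetSpace E F Y) (hq : q.1 ∈ chartDom (E := E) F Y x₀) (t : ℝ)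
    (ht : contraction (vertProj E F r) t (coord r x₀ q hq) ∈ O) (ξ : Fin p → TangentJet q) :
    φ ⟨q.1, t • q.2⟩ ξ = η (contraction (vertProj E F r) t (coord r x₀ q hq))
      (fun i => frame r x₀ q hq (ξ i)) := by
  rw [← coord_smul] at ht ⊢
  exact h ⟨q.1, t • q.2⟩ hq ht ξ

theorem IsFrameRepr.homotopyForm [FiniteDimensional ℝ E] [FiniteDimensional ℝ F]
    {p r : ℕ} {φ : PreForm E F Y (p + 1)} {x₀ : X} {O W : Set (CoordSpace E F r)}
    {η : CoordSpace E F r → CoordSpace E F r [⋀^Fin (p + 1)]→L[ℝ] ℝ}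
    (h : IsFrameRepr φ x₀ O η) (hη : ContDiff ℝ ∞ η)
    (hW : ∀ c ∈ W, ∀ t ∈ Set.Icc (0 : ℝ) 1, contraction (vertProj E F r) t c ∈ O) :
    IsFrameRepr (homotopyForm φ) x₀ W (homotopyOp (vertProj E F r) η) := by
  intro q hq hqW ξ
  rw [homotopyOp_apply _ hη]
  refine intervalIntegral.integral_congr fun t ht => ?_
  rw [Set.uIcc_of_le zero_le_one] at ht
  have e := h.apply_smul q hq t (hW _ hqW t ht) (Fin.cons (α := fun _ => TangentJet q) (0, q.2)
      (fun i => ((ξ i).1, t • (ξ i).2)))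
  rwa [frame_cons] at e

theorem IsLocPullback.homotopyForm [FiniteDimensional ℝ E] [FiniteDimensional ℝ F]
    {p : ℕ} {φ : PreForm E F Y (p + 1)} (hφ : IsLocPullback φ) :
    IsLocPullback (homotopyForm φ) := by
  refine isLocPullback_of_frameRepr fun q₀ => ?_
  obtain ⟨r, O, hO, ⟨η, hη, h⟩, W, hW, hqW, hWO⟩ := hφ.exists_frameRepr_segment q₀
  exact ⟨r, W, hW, hqW, _, (contDiff_homotopyOp _ hη).contDiffOn, h.homotopyForm hη hWO⟩

/-- The inserted radial vector is vertical: the vertical slots become slot `0` and the shift of `S`,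
one more than before. -/
theorem IsContact.homotopyForm {p k : ℕ} {φ : PreForm E F Y (p + 1)}
    (hφ : IsContact (k + 1) φ) : IsContact k (homotopyForm φ) := by
  classical
  intro q ξ S hS hS' hcard
  have hz : ∀ t : ℝ, φ ⟨q.1, t • q.2⟩ (Fin.cons (α := fun _ => TangentJet q) (0, q.2)
      fun i => ((ξ i).1, t • (ξ i).2)) = 0 := by
    intro t
    refine hφ ⟨q.1, t • q.2⟩ _ (insert 0 (S.map (Fin.succEmb p))) ?_ ?_ ?_
    · intro i
      refine Fin.cases (fun _ => rfl) (fun i hi => ?_) i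
      exact hS i (by simpa [Fin.succ_ne_zero] using hi)
    · intro i
      refine Fin.cases (fun h => absurd (Finset.mem_insert_self _ _) h) (fun i hi => ?_) i
      have := hS' i (by simpa [Fin.succ_ne_zero] using hi)
      change t • (ξ i).2 = 0
      rw [this, smul_zero]
    · rw [Finset.card_insert_of_notMem (by simp [Fin.succ_ne_zero]), Finset.card_map]
      simpa using hcard
  change ∫ t in (0 : ℝ)..1, _ = 0
  simp only [hz]
  exact intervalIntegral.integral_zero

theorem vertDiff_homotopyForm [FiniteDimensional ℝ E] [FiniteDimensional ℝ F]
    {p k : ℕ} {φ : PreForm E F Y (p + 1)} (hφ : IsLocPullback φ) (hk : IsContact (k + 1) φ)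
    (hd : vertDiff φ = 0) : vertDiff (homotopyForm φ) = φ := by
  funext q ξ
  obtain ⟨r, O, hO, ⟨η, hη, h⟩, W, hW, hqW, hWO⟩ := hφ.exists_frameRepr_segment q
  have hq := mem_chartDom_self (E := E) F Y q.1
  rw [(h.homotopyForm hη hWO).vertDiff hW (contDiff_homotopyOp _ hη).contDiffOn q hq hqW ξ,
    extDerivAlong_homotopyOp _ (vertProj_vertProj r) hη _ _ fun t ht => ?_]
  · have h1 := hWO _ hqW 1 (by simp)
    rw [contraction_one] at h1
    -- At `t = 0` all vertical parts are scaled away, so the boundary term is `φ` on horizontal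
    -- vectors; it vanishes because the empty set has cardinality `0 ≠ k + 1`.
    have h0 := h.apply_smul q hq 0 (hWO _ hqW 0 (by simp)) fun i => ((ξ i).1, (0 : ℝ) • (ξ i).2)
    simp only [frame_smul] at h0
    rw [h q hq h1 ξ, ← h0, sub_eq_self]
    refine hk _ _ ∅ (by simp) (fun i _ => zero_smul ℝ _) (by simp)
  -- The representative `η` need not be closed away from coordinates of jets, but here the base
  -- point and all the arguments come from jets.
  · have e := (h.vertDiff hO hη.contDiffOn).apply_smul q hq t (hWO _ hqW t ht)
      (Fin.cons (α := fun _ => TangentJet q) (0, q.2) (fun i => ((ξ i).1, t • (ξ i).2)))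
    rw [frame_cons, hd] at e
    exact e.symm

/-! ### Pull-back from `X` and restriction to the zero section. -/

theorem IsBaseForm.isLocPullback_pullbackBase {p : ℕ} {α : BasePreForm E X p}
    (hα : IsBaseForm α) : IsLocPullback (pullbackBase (F := F) (Y := Y) α) := by
  intro q₀
  obtain ⟨W, hW, hxW, η, hη, h⟩ := hα q₀.1
  let L : CoordSpace E F 0 →L[ℝ] E :=
    ContinuousLinearMap.fst ℝ E (∀ k : Fin (0 + 1), E [×(k : ℕ)]→L[ℝ] F)
  refine ⟨0, L ⁻¹' W, hW.preimage L.continuous, hxW,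
    fun c => (η (L c)).compContinuousLinearMap L, ?_, fun q hq hqW ξ => h q.1 hq.1 hqW _⟩
  exact (ContinuousAlternatingMap.compContinuousLinearMapCLM L).contDiff.comp_contDiffOn
    (hη.comp L.contDiff.contDiffOn fun _ h => h)

theorem IsBaseForm.isContact_pullbackBase {p : ℕ} {α : BasePreForm E X p}
    (hα : IsBaseForm α) : IsContact 0 (pullbackBase (F := F) (Y := Y) α) := by
  intro q ξ S hS _ hcard
  obtain ⟨i, hi⟩ := Finset.card_ne_zero.1 hcard
  obtain ⟨W, -, hxW, η, -, h⟩ := hα q.1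
  change α q.1 _ = 0
  rw [h q.1 (mem_chart_source E q.1) hxW]
  refine (η _).map_coord_zero i ?_
  rw [hS i hi, map_zero]

/-- The pull-back of exterior forms from `X` to `J^∞ Y`. -/
def pullbackLinear (F : Type*) [NormedAddCommGroup F] [NormedSpace ℝ F]
    (Y : X → Type*) [TopologicalSpace (TotalSpace F Y)]
    [∀ x, AddCommGroup (Y x)] [∀ x, Module ℝ (Y x)] [∀ x, TopologicalSpace (Y x)]
    [FiberBundle F Y] [VectorBundle ℝ F Y] [ContMDiffVectorBundle ∞ F Y 𝓘(ℝ, E)] (m : ℕ) :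
    baseForms E X m →ₗ[ℝ] contactForms E F Y 0 m where
  toFun α := ⟨pullbackBase α.1, IsBaseForm.isLocPullback_pullbackBase α.2,
    IsBaseForm.isContact_pullbackBase α.2⟩
  map_add' _ _ := rfl
  map_smul' _ _ := rfl

/-- The restriction of a form on `J^∞ Y` to the zero section of `J^∞ Y → X`. -/
def zeroSectionForm {p : ℕ} (φ : PreForm E F Y p) : BasePreForm E X p :=
  fun x w => φ ⟨x, 0⟩ fun i => (w i, 0)

theorem IsLocPullback.isBaseForm_zeroSectionForm [FiniteDimensional ℝ E] [FiniteDimensional ℝ F]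
    {p : ℕ} {φ : PreForm E F Y p} (hφ : IsLocPullback φ) : IsBaseForm (zeroSectionForm φ) := by
  intro x₀
  obtain ⟨r, W, hW, hxW, η, hη, h⟩ := hφ.exists_frameRepr (⟨x₀, 0⟩ : JetSpace E F Y)
  let L : E →L[ℝ] CoordSpace E F r :=
    ContinuousLinearMap.inl ℝ E (∀ k : Fin (r + 1), E [×(k : ℕ)]→L[ℝ] F)
  have hcoord : ∀ (x : X) (hx : x ∈ chartDom (E := E) F Y x₀),
      coord r x₀ (⟨x, 0⟩ : JetSpace E F Y) hx = L (extChartAt 𝓘(ℝ, E) x₀ x) := fun x hx =>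
    CoordSpace.ext_coord rfl fun k => map_zero _
  have hframe : ∀ (x : X) (hx : x ∈ chartDom (E := E) F Y x₀) (w : TangentSpace 𝓘(ℝ, E) x),
      frame r x₀ (⟨x, 0⟩ : JetSpace E F Y) hx (w, 0) = L (baseCoordDiff x₀ x w) := fun x hx w =>
    CoordSpace.ext_coord rfl fun k => map_zero _
  -- `IsBaseForm` ranges over the whole chart source, while the bundle chart exists only where `Y`
  -- is trivialized; the open set is therefore cut down to the image of that domain.
  have ho : IsOpen ((extChartAt 𝓘(ℝ, E) x₀).target ∩
      (extChartAt 𝓘(ℝ, E) x₀).symm ⁻¹' (trivializationAt F Y x₀).baseSet) :=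
    (continuousOn_extChartAt_symm x₀).isOpen_inter_preimage (isOpen_extChartAt_target x₀)
      (trivializationAt F Y x₀).open_baseSet
  refine ⟨L ⁻¹' W ∩ _, (hW.preimage L.continuous).inter ho, ⟨?_, mem_extChartAt_target x₀, ?_⟩,
    fun u => (η (L u)).compContinuousLinearMap L, ?_, fun x hx hxW' w => ?_⟩
  · rw [Set.mem_preimage, ← hcoord x₀ (mem_chartDom_self F Y x₀)]
    exact hxW
  · rw [Set.mem_preimage, extChartAt_to_inv]
    exact mem_baseSet_trivializationAt F Y x₀
  · exact (ContinuousAlternatingMap.compContinuousLinearMapCLM L).contDiff.comp_contDiffOn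
      (hη.comp (t := W) L.contDiff.contDiffOn fun _ h => (Set.mem_of_mem_inter_left h :))
  · have hx' : x ∈ chartDom (E := E) F Y x₀ := by
      refine ⟨hx, ?_⟩
      have := hxW'.2.2
      rwa [Set.mem_preimage, (extChartAt 𝓘(ℝ, E) x₀).left_inv (by rwa [extChartAt_source])] at this
    have e := h ⟨x, 0⟩ hx' (by rw [hcoord]; exact hxW'.1) fun i => (w i, 0)
    simp only [hcoord, hframe] at e
    exact e

/-- A `0`-contact form depends only on the horizontal parts of its arguments. -/
theorem IsContact.apply_eq_apply_horizontal [FiniteDimensional ℝ E] [FiniteDimensional ℝ F]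
    {p : ℕ} {φ : PreForm E F Y p} (hφ : IsLocPullback φ) (h0 : IsContact 0 φ) (q : JetSpace E F Y)
    (ξ : Fin p → TangentJet q) : φ q ξ = φ q fun i => ((ξ i).1, 0) := by
  classical
  obtain ⟨r, W, hW, hxW, η, hη, h⟩ := hφ.exists_frameRepr q
  have hq := mem_chartDom_self (E := E) F Y q.1
  have hadd : ∀ ζ : TangentJet q, frame r q.1 q hq ζ
      = frame r q.1 q hq (ζ.1, 0) + frame r q.1 q hq (0, ζ.2) := fun ζ => by
    refine CoordSpace.ext_coord ?_ fun k => ?_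
    · change baseCoordDiff q.1 q.1 ζ.1 = baseCoordDiff q.1 q.1 ζ.1 + baseCoordDiff q.1 q.1 0
      rw [map_zero, add_zero]
    · change jetCoord F Y q.1 q.1 hq k ζ.2
        = jetCoord F Y q.1 q.1 hq k 0 + jetCoord F Y q.1 q.1 hq k ζ.2
      rw [map_zero, zero_add]
  -- Multilinearity is available only through the representative. Every term of the expansion with a
  -- slot filled by a vertical part vanishes by contact degree zero, leaving the purely horizontal
  -- term.
  have hsum := (η (coord r q.1 q hq)).toMultilinearMap.map_add_univ
    (fun i => frame r q.1 q hq ((ξ i).1, 0)) (fun i => frame r q.1 q hq (0, (ξ i).2))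
  rw [Finset.sum_eq_single Finset.univ] at hsum
  · rw [h q hq hxW ξ, h q hq hxW]
    simp only [Finset.piecewise_univ] at hsum
    rw [show (fun i => frame r q.1 q hq (ξ i)) = _ from funext fun i => hadd (ξ i)]
    exact hsum
  · intro S _ hS
    let ζ : Fin p → TangentJet q := S.piecewise (fun i => ((ξ i).1, 0)) fun i => (0, (ξ i).2)
    have hζ : S.piecewise (fun i => frame r q.1 q hq ((ξ i).1, 0))
        (fun i => frame r q.1 q hq (0, (ξ i).2)) = fun i => frame r q.1 q hq (ζ i) := by
      funext i
      by_cases hi : i ∈ S <;> simp [ζ, hi]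
    rw [hζ]
    refine (h q hq hxW ζ).symm.trans (h0 q ζ Sᶜ (fun i hi => ?_) (fun i hi => ?_) ?_)
    · have hi' : i ∉ S := by simpa using hi
      simp [ζ, hi']
    · have hi' : i ∈ S := by simpa using hi
      simp [ζ, hi']
    · rwa [Ne, Finset.card_eq_zero, Finset.compl_eq_empty_iff]
  · simp

/-- A horizontal argument does not move the jet, so every summand but the first is the derivative of
a constant. -/
theorem vertDiff_apply_of_horizontal {p : ℕ} (φ : PreForm E F Y p) (q : JetSpace E F Y)
    (b : Fin (p + 1) → TangentJet q) (hb : ∀ i : Fin p, (b i.succ).2 = 0) :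
    vertDiff φ q b
      = deriv (fun t : ℝ => φ ⟨q.1, q.2 + t • (b 0).2⟩ fun i => b i.succ) 0 := by
  rw [vertDiff, Fin.sum_univ_succ, Finset.sum_eq_zero, add_zero, Fin.val_zero, pow_zero, one_mul]
  · simp only [Fin.succAbove_zero]
  · intro i _
    have hz : (fun t : ℝ => φ ⟨q.1, q.2 + t • (b i.succ).2⟩ fun j => b (i.succ.succAbove j))
        = fun _ => φ q fun j => b (i.succ.succAbove j) := funext fun t => by
      have e : q.2 + t • (b i.succ).2 = q.2 := by rw [hb, smul_zero, add_zero]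
      exact congrArg (fun v : JetInf E F Y q.1 => φ ⟨q.1, v⟩ fun j => b (i.succ.succAbove j)) e
    rw [hz, deriv_const, mul_zero]

/-- The derivative is known only at `s = 0`, but from every starting point; starting at `u = t • v`
covers the whole line through `0` and `v`. -/
theorem eq_apply_zero_of_hasDerivAt_line {V : Type*} [AddCommMonoid V] [Module ℝ V] {g : V → ℝ}
    {v : V} (h : ∀ u : V, HasDerivAt (fun s : ℝ => g (u + s • v)) 0 0) : g v = g 0 := by
  have hf : ∀ t, HasDerivAt (fun t : ℝ => g (t • v)) 0 t := fun t => by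
    have h1 : HasDerivAt (fun s : ℝ => g (t • v + s • v)) 0 (t - t) := by
      rw [sub_self]; exact h (t • v)
    have h2 := HasDerivAt.comp_sub_const t t h1
    simpa only [← add_smul, add_sub_cancel] using h2
  have hc := is_const_of_deriv_eq_zero (fun t => (hf t).differentiableAt)
    (fun t => (hf t).deriv) 1 0
  simpa using hc

theorem IsLocPullback.hasDerivAt_horizontal [FiniteDimensional ℝ E] [FiniteDimensional ℝ F]
    {p : ℕ} {φ : PreForm E F Y p} (hφ : IsLocPullback φ) (hd : JetForms.vertDiff φ = 0)
    (q : JetSpace E F Y) (v : JetInf E F Y q.1) (w : Fin p → TangentSpace 𝓘(ℝ, E) q.1) :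
    HasDerivAt (fun s : ℝ => φ ⟨q.1, q.2 + s • v⟩ fun i => (w i, 0)) 0 0 := by
  have h1 := (hφ.differentiableAt q v fun i => (w i, 0)).hasDerivAt
  have h0 := vertDiff_apply_of_horizontal φ q
    (Fin.cons (α := fun _ => TangentJet q) (0, v) fun i => (w i, 0)) fun _ => rfl
  rw [hd] at h0
  have h2 : deriv (fun s : ℝ => φ ⟨q.1, q.2 + s • v⟩ fun i => (w i, 0)) 0 = 0 := h0.symm
  rwa [h2] at h1

theorem eq_pullbackBase_zeroSectionForm [FiniteDimensional ℝ E] [FiniteDimensional ℝ F]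
    {p : ℕ} {φ : PreForm E F Y p} (hφ : IsLocPullback φ) (h0 : IsContact 0 φ)
    (hd : vertDiff φ = 0) : pullbackBase (zeroSectionForm φ) = φ := by
  funext q ξ
  rw [h0.apply_eq_apply_horizontal hφ]
  have h := fun u => hφ.hasDerivAt_horizontal hd ⟨q.1, u⟩ q.2 fun i => (ξ i).1
  exact (eq_apply_zero_of_hasDerivAt_line
    (g := fun v : JetInf E F Y q.1 => φ ⟨q.1, v⟩ fun i => ((ξ i).1, 0)) h).symm

theorem vertDiff_pullbackBase {p : ℕ} (α : BasePreForm E X p) :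
    vertDiff (pullbackBase (F := F) (Y := Y) α) = 0 := by
  funext q ξ
  exact Finset.sum_eq_zero fun i _ => mul_eq_zero_of_right _
    (deriv_const (0 : ℝ) (α q.1 fun j => (ξ (i.succAbove j)).1))

/-! ### Exactness of the vertical complex. -/

theorem pullbackLinear_injective (m : ℕ) :
    Function.Injective (pullbackLinear (E := E) (X := X) F Y m) := by
  intro α β h
  apply Subtype.ext
  funext x w
  exact congrFun (congrFun (congrArg Subtype.val h) ⟨x, 0⟩) fun i => (w i, 0)

theorem exact_pullbackLinear_vertDiffLinear [FiniteDimensional ℝ E] [FiniteDimensional ℝ F]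
    (m : ℕ) : Function.Exact (pullbackLinear (E := E) (X := X) F Y m) (vertDiffLinear 0 m) := by
  intro φ
  constructor
  · intro h
    exact ⟨⟨zeroSectionForm φ.1, φ.2.1.isBaseForm_zeroSectionForm⟩,
      Subtype.ext (eq_pullbackBase_zeroSectionForm φ.2.1 φ.2.2 (congrArg Subtype.val h))⟩
  · rintro ⟨α, rfl⟩
    exact Subtype.ext (vertDiff_pullbackBase α.1)

theorem exact_vertDiffLinear [FiniteDimensional ℝ E] [FiniteDimensional ℝ F] (k m : ℕ) :
    Function.Exact (vertDiffLinear (E := E) (X := X) (F := F) (Y := Y) k m)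
      (vertDiffLinear (k + 1) m) := by
  intro φ
  constructor
  · intro h
    -- The degree `m + (k + 1)` is definitionally `(m + k) + 1`; the explicit `p` selects this
    -- reading.
    exact ⟨⟨homotopyForm (p := m + k) φ.1, IsLocPullback.homotopyForm (p := m + k) φ.2.1,
      IsContact.homotopyForm (p := m + k) φ.2.2⟩,
      Subtype.ext (vertDiff_homotopyForm (p := m + k) φ.2.1 φ.2.2 (congrArg Subtype.val h))⟩
  · rintro ⟨ψ, rfl⟩
    exact Subtype.ext ψ.2.1.vertDiff_vertDiff

end Jets

end JetForms

end

theorem mainTheorem4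
    {E : Type*} [NormedAddCommGroup E] [NormedSpace ℝ E] [FiniteDimensional ℝ E]
    {X : Type*} [TopologicalSpace X] [ChartedSpace E X] [IsManifold 𝓘(ℝ, E) ∞ X]
    [T2Space X] [ParacompactSpace X] [ConnectedSpace X]
    (F : Type*) [NormedAddCommGroup F] [NormedSpace ℝ F] [FiniteDimensional ℝ F]
    (Y : X → Type*) [TopologicalSpace (TotalSpace F Y)]
    [∀ x, AddCommGroup (Y x)] [∀ x, Module ℝ (Y x)] [∀ x, TopologicalSpace (Y x)]
    [FiberBundle F Y] [VectorBundle ℝ F Y] [ContMDiffVectorBundle ∞ F Y 𝓘(ℝ, E)]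
    (m : ℕ) (hm : m ≤ Module.finrank ℝ E) :
    ∃ (pullback : JetForms.baseForms E X m →ₗ[ℝ] JetForms.contactForms E F Y 0 m)
      (dV : ∀ k : ℕ,
        JetForms.contactForms E F Y k m →ₗ[ℝ] JetForms.contactForms E F Y (k + 1) m),
      (∀ α : JetForms.baseForms E X m,
        (pullback α : JetForms.PreForm E F Y (m + 0)) = JetForms.pullbackBase α.1) ∧
      (∀ (k : ℕ) (φ : JetForms.contactForms E F Y k m),
        (dV k φ : JetForms.PreForm E F Y (m + (k + 1))) = JetForms.vertDiff φ.1) ∧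
      Function.Injective pullback ∧
      Function.Exact pullback (dV 0) ∧
      ∀ k : ℕ, Function.Exact (dV k) (dV (k + 1)) := by
  exact ⟨JetForms.pullbackLinear F Y m, fun k => JetForms.vertDiffLinear k m,
    fun _ => rfl, fun _ _ => rfl, JetForms.pullbackLinear_injective m,
    JetForms.exact_pullbackLinear_vertDiffLinear m, fun k => JetForms.exact_vertDiffLinear k m⟩
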